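/- \textbf{Bi-orthogonality relations for the non-symmetric Koornwinder polynomials.} \emph{Setting.} Let $n\ge 2$, $\Lambda=\bigoplus_{i=1}^n\mathbb{Z}\epsilon_i$ with $\langle\epsilon_i,\epsilon_j\rangle=\delta_{ij}$, and $\mathcal{A}=\mathbb{C}[x_1^{\pm1},\dots,x_n^{\pm1}]$ with monomials $x^\lambda$, $\lambda\in\Lambda$. On $\Lambda\oplus\mathbb{Z}\delta$ (with $\delta$ in the radical of $\langle\cdot,\cdot\rangle$) let $s_\beta(g)=g-\langle g,\beta^\vee\rangle\beta$, $\beta^\vee=2\beta/\langle\beta,\beta\rangle$, for $\beta$ in $R=\{\pm2\epsilon_i+m\delta\}\cup\{\pm\epsilon_i\pm\epsilon_j+m\delta: i<j\}$ ($m\in\mathbb{Z}$). Let $a_0=\delta-2\epsilon_1$, $a_i=\epsilon_i-\epsilon_{i+1}$ ($0<i<n$), $a_n=2\epsilon_n$, $s_i=s_{a_i}$, and let $\tau(\lambda)f=f+\langle\lambda,f\rangle\delta$, an element of the affine Weyl group generated by $s_0,\dots,s_n$. Let $\Sigma^+=\{2\epsilon_i\}\cup\{\epsilon_i\pm\epsilon_j:i<j\}$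 and $R^+=\Sigma^+\cup\{\alpha+m\delta\in R: m>0\}$. \emph{Parameters.} Let $\mathbf{t}=(t_0,t,t_n,t_0^\vee,t_n^\vee)$ be non-zero complex numbers, $q^{1/2}$ a fixed square root of $q$, and $$a=t_0t_0^\vee q^{1/2},\quad b=-t_0(t_0^\vee)^{-1}q^{1/2},\quad c=t_nt_n^\vee,\quad d=-t_n(t_n^\vee)^{-1}.$$ Assume $0<q,t<1$ and $|a|,|b|,|c|,|d|<1$. Put $x^{\mu+m\delta}=q^mx^\mu$ and $s_\beta(x^\mu)=x^{s_\beta\mu}$. For $\beta=\alpha+m\delta\in R$ set $v_\beta(x)=\dfrac{1-t^2x^\beta}{1-x^\beta}$ if $\alpha=\pm\epsilon_i\pm\epsilon_j$, and, if $\alpha=\pm2\epsilon_i$, $$v_\beta(x)=\frac{(1-uu'x^{\beta/2})(1+u(u')^{-1}x^{\beta/2})}{1-x^\beta},\qquad x^{\beta/2}=(q^{1/2})^{m}x^{\alpha/2},$$ with $(u,u')=(t_n,t_n^\vee)$ for $m$ even and $(t_0,t_0^\vee)$ for $m$ odd. \emph{Operators.} Let $T_i=t_i+t_i^{-1}v_{a_i}(x)(s_i-\mathrm{id})\in\mathrm{End}_{\mathbb{C}}(\mathcal{A})$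 for $i=0,\dots,n$, with $t_i=t$ for $0<i<n$. For $\lambda=\mu-\nu$ with $\mu,\nu$ dominant ($\mu_1\ge\dots\ge\mu_n\ge0$) let $Y^\lambda=T_{\tau(\mu)}T_{\tau(\nu)}^{-1}$, where $T_w=T_{i_1}\cdots T_{i_r}$ for a reduced expression $w=s_{i_1}\cdots s_{i_r}$; put $f(Y)=\sum_\lambda c_\lambda Y^\lambda$ for $f=\sum_\lambda c_\lambda x^\lambda$. \emph{Polynomials.} Let $W$ be the group of permutations and sign changes of the coordinates and $\lambda^+$ the dominant weight in $W\lambda$. Write $\lambda\le\mu$ if $\mu-\lambda$ is a non-negative integral combination of $\epsilon_i-\epsilon_{i+1}$ ($0<i<n$) and $\epsilon_n$, and $\lambda\prec\mu$ if $\lambda\ne\mu$ and either $\lambda^+<\mu^+$, or $\lambda^+=\mu^+$ and $\lambda\le\mu$. With $\mathrm{sgn}(m)=1$ for $m\ge0$ and $-1$ for $m<0$, put $\rho_l(\lambda)=\sum_i\mathrm{sgn}(\lambda_i)\epsilon_i$, $$\rho_m(\lambda)=\sum_{i<j}\bigl(\mathrm{sgn}(\lambda_i-\lambda_j)(\epsilon_i-\epsilon_j)+\mathrm{sgn}(\lambda_i+\lambda_j)(\epsilon_i+\epsilon_j)\bigr),\qquad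 \gamma_\lambda=(t_0t_n)^{\rho_l(\lambda)}\,t^{\rho_m(\lambda)}\,q^{\lambda}\in(\mathbb{C}^\times)^n,$$ where $z^\lambda=(z^{\lambda_1},\dots,z^{\lambda_n})$ for $z\in\mathbb{C}^\times$ and products are taken coordinatewise. The monic non-symmetric Koornwinder polynomial $P_\lambda$ is the Laurent polynomial of the form $x^\lambda+\sum_{\mu\prec\lambda}c_{\lambda,\mu}x^\mu$ with $f(Y)P_\lambda=f(\gamma_\lambda)P_\lambda$ for all $f\in\mathcal{A}$. Let $x_0$ be the point obtained from $\gamma_0$ by interchanging $t_0$ and $t_n^\vee$. The normalized polynomial $E(\gamma_\lambda;\cdot)$ is the constant multiple of $P_\lambda$ with value $1$ at $x_0^{-1}$, and $E'(\gamma_\mu^{-1};\cdot)$ is the normalized polynomial of degree $\mu$ for the inverse parameters $(\mathbf{t}^{-1},q^{-1})$ (with square root $(q^{1/2})^{-1}$ of $q^{-1}$). \emph{Bilinear form.} Let $\Delta(x)=\prod_{\beta\in R^+}v_\beta(x)^{-1}$ and $$\langle f,g\rangle=\frac1{(2\pi i)^n}\int_{\mathbb{T}^n}f(x)\,g(x^{-1})\,\Delta(x)\,\frac{dx_1}{x_1}\cdots\frac{dx_n}{x_n},$$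 $\mathbb{T}$ being the positively oriented unit circle. \emph{Claim.} Let $\lambda,\mu\in\Lambda$ with $\lambda\ne\mu$. If $E(\gamma_\lambda;\cdot)$ and $E'(\gamma_\mu^{-1};\cdot)$ are the normalized non-symmetric Koornwinder polynomials just defined, then the product $\Delta$ converges unconditionally at every point of $\mathbb{T}^n$, the integral $\langle E(\gamma_\lambda;\cdot),E'(\gamma_\mu^{-1};\cdot)\rangle$ converges absolutely, and $$\langle E(\gamma_\lambda;\cdot),\,E'(\gamma_\mu^{-1};\cdot)\rangle=0 .$$ -/

import Mathlib

noncomputable section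

namespace Koornwinder

/-! ### The affine root system of type `C^∨ C_n` and its affine Weyl group -/

/-- The lattice `Λ ⊕ ℤ δ` of affine linear functions, `Λ = ℤ ε_1 ⊕ … ⊕ ℤ ε_n`:
the pair `(μ, m)` is `μ + m δ`. It contains the affine root system `R` and is stable under the
affine Weyl group. -/
abbrev AffLat (n : ℕ) : Type := (Fin n → ℤ) × ℤ

/-- The standard scalar product on `Λ`. -/
def dot {n : ℕ} (u v : Fin n → ℤ) : ℤ := ∑ k, u k * v k

/-- The basis vector `ε_i` with `i = 1, …, n` (the coordinates are labelled by `Fin n`, so that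
the `i`-th coordinate has label `i - 1`). -/
def eps (n i : ℕ) : Fin n → ℤ := fun k => if (k : ℕ) + 1 = i then 1 else 0

/-- `⟨g, β^∨⟩ = 2 ⟨g, β⟩ / ⟨β, β⟩` for `g = μ + m δ`; the division is exact for every root. -/
def corootPairing {n : ℕ} (β : AffLat n) (μ : Fin n → ℤ) : ℤ :=
  (2 * dot μ β.1) / dot β.1 β.1

/-- The reflection `s_β(g) = g - ⟨g, β^∨⟩ β`. -/
def refl {n : ℕ} (β g : AffLat n) : AffLat n := g - corootPairing β g.1 • β

/-- The simple roots `a_0 = δ - 2 ε_1`, `a_i = ε_i - ε_{i+1}` (`0 < i < n`), `a_n = 2 ε_n`. -/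
def simpleRoot {n : ℕ} (i : Fin (n + 1)) : AffLat n :=
  if (i : ℕ) = 0 then ((-2 : ℤ) • eps n 1, 1)
  else if (i : ℕ) = n then ((2 : ℤ) • eps n n, 0)
  else (eps n i - eps n (i + 1), 0)

/-- The element `s_{i_1} ⋯ s_{i_r}` of the affine Weyl group attached to `[i_1, …, i_r]`. -/
def wordAct {n : ℕ} (w : List (Fin (n + 1))) (g : AffLat n) : AffLat n :=
  w.foldr (fun i h => refl (simpleRoot i) h) g

/-- The translation `τ(v) f = f + ⟨v, f⟩ δ`. -/
def translation {n : ℕ} (v : Fin n → ℤ) (g : AffLat n) : AffLat n := (g.1, g.2 + dot v g.1)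

/-- `w` is a word in the simple reflections for `τ(v)`. -/
def IsWordFor {n : ℕ} (v : Fin n → ℤ) (w : List (Fin (n + 1))) : Prop :=
  ∀ g : AffLat n, wordAct w g = translation v g

/-- `w` is a reduced expression of `τ(v)`. -/
def IsReducedWordFor {n : ℕ} (v : Fin n → ℤ) (w : List (Fin (n + 1))) : Prop :=
  IsWordFor v w ∧ ∀ w', IsWordFor v w' → w.length ≤ w'.length

/-- Gradients of the long roots: `± 2 ε_i`. -/
def IsLong {n : ℕ} (α : Fin n → ℤ) : Prop :=
  ∃ i, α = Pi.single i 2 ∨ α = -Pi.single i 2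

/-- Gradients of the medium roots: `± ε_i ± ε_j`, `i < j`. -/
def IsMedium {n : ℕ} (α : Fin n → ℤ) : Prop :=
  ∃ i j : Fin n, i < j ∧ ∃ r s : ℤˣ, α = Pi.single i (r : ℤ) + Pi.single j (s : ℤ)

/-- The positive roots `Σ⁺ = {2 ε_i} ∪ {ε_i ± ε_j : i < j}` of the gradient root system. -/
def IsPosGradient {n : ℕ} (α : Fin n → ℤ) : Prop :=
  (∃ i, α = Pi.single i 2) ∨
    ∃ i j : Fin n, i < j ∧ ∃ s : ℤˣ, α = Pi.single i 1 + Pi.single j (s : ℤ)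

/-- The positive affine roots `R⁺ = Σ⁺ ∪ {β ∈ R : β(0) > 0}`, where
`R = {± 2 ε_i + m δ} ∪ {± ε_i ± ε_j + m δ}`. -/
def posRoots (n : ℕ) : Set (AffLat n) :=
  {β | (IsLong β.1 ∨ IsMedium β.1) ∧ (0 < β.2 ∨ (β.2 = 0 ∧ IsPosGradient β.1))}

/-! ### Parameters -/

/-- A multiplicity function `𝐭`, given by its values on the five orbits of the affine Weyl group,
and a square root `q^{1/2}` of `q`. -/
structure Params where
  /-- `q^{1/2}` -/
  qh : ℂˣ
  /-- `t_{a_0}` -/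
  t0 : ℂˣ
  /-- `t = t_{a_i}`, `0 < i < n` -/
  t : ℂˣ
  /-- `t_{a_n}` -/
  tn : ℂˣ
  /-- `t_{a_0^∨}` -/
  t0v : ℂˣ
  /-- `t_{a_n^∨}` -/
  tnv : ℂˣ

namespace Params

/-- The inverse parameters `(𝐭⁻¹, q⁻¹)`. -/
def inv (p : Params) : Params := ⟨p.qh⁻¹, p.t0⁻¹, p.t⁻¹, p.tn⁻¹, p.t0v⁻¹, p.tnv⁻¹⟩

/-- The dual parameters: `t_{a_0}` and `t_{a_n^∨}` are interchanged. -/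
def dual (p : Params) : Params := ⟨p.qh, p.tnv, p.t, p.tn, p.t0v, p.t0⟩

/-- `q` -/
def q (p : Params) : ℂˣ := p.qh ^ 2

/-- `a = t_0 t_0^∨ q^{1/2}` -/
def a (p : Params) : ℂ := p.t0 * p.t0v * p.qh

/-- `b = - t_0 (t_0^∨)⁻¹ q^{1/2}` -/
def b (p : Params) : ℂ := -(p.t0 * (p.t0v : ℂ)⁻¹ * p.qh)

/-- `c = t_n t_n^∨` -/
def c (p : Params) : ℂ := p.tn * p.tnv

/-- `d = - t_n (t_n^∨)⁻¹` -/
def d (p : Params) : ℂ := -(p.tn * (p.tnv : ℂ)⁻¹)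

open Classical in
/-- `t_β` for `β ∈ R`: the orbits of `a_0`, `a_n`, `a_i` are
`Σ_l + (1 + 2ℤ) δ`, `Σ_l + 2ℤ δ`, `Σ_m + ℤ δ`. -/
def mult {n : ℕ} (p : Params) (β : AffLat n) : ℂˣ :=
  if IsLong β.1 then (if Even β.2 then p.tn else p.t0) else p.t

/-- `t_{β/2}` for a long root `β = ± 2 ε_i + m δ`, so `β/2 = ± ε_i + (m/2) δ`. -/
def multHalf {n : ℕ} (p : Params) (β : AffLat n) : ℂˣ :=
  if Even β.2 then p.tnv else p.t0v

end Params

/-! ### Laurent polynomials and the Noumi representation -/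

/-- The group algebra `𝒜` of `Λ`, i.e. the Laurent polynomials in `x_1, …, x_n`. -/
abbrev Laurent (n : ℕ) : Type := AddMonoidAlgebra ℂ (Fin n → ℤ)

/-- The value of a Laurent polynomial at a point with non-zero coordinates. -/
def eval {n : ℕ} (x : Fin n → ℂ) (f : Laurent n) : ℂ :=
  f.coeff.sum fun μ z => z * ∏ k, x k ^ μ k

/-- The linear map with prescribed values on the monomials `x^μ`. -/
def linExt {n : ℕ} (b : (Fin n → ℤ) → Laurent n) : Laurent n →ₗ[ℂ] Laurent n where
  toFun f := f.coeff.sum fun μ z => z • b μ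
  map_add' f g := by
    rw [AddMonoidAlgebra.coeff_add]
    exact Finsupp.sum_add_index' (by simp) (by intros; rw [add_smul])
  map_smul' z f := by
    rw [AddMonoidAlgebra.coeff_smul, Finsupp.sum_smul_index' (by simp)]
    simp [Finsupp.smul_sum, mul_smul]

/-- The monomial `x^{μ + m δ} = q^m x^μ`. -/
def mono {n : ℕ} (p : Params) (g : AffLat n) : Laurent n :=
  AddMonoidAlgebra.single g.1 ((p.q ^ g.2 : ℂˣ) : ℂ)

/-- The action of `s_β` on `𝒜`: `x^μ ↦ x^{s_β μ}`. -/
def reflAct {n : ℕ} (p : Params) (β : AffLat n) : Laurent n →ₗ[ℂ] Laurent n :=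
  linExt fun μ => mono p (refl β (μ, 0))

/-- The divided difference `f ↦ (f - s_β f) / (1 - x^β)`, see `mul_divDiff`. On monomials,
with `k = ⟨μ, β^∨⟩`, it maps `x^μ` to `- ∑_{r=1}^{k} x^{μ - r β}` for `k ≥ 0` and to
`∑_{r=0}^{-k-1} x^{μ + r β}` for `k < 0`. -/
def divDiff {n : ℕ} (p : Params) (β : AffLat n) : Laurent n →ₗ[ℂ] Laurent n :=
  linExt fun μ =>
    if 0 ≤ corootPairing β μ then
      -∑ r ∈ Finset.range (corootPairing β μ).toNat, mono p ((μ, 0) - ((r : ℤ) + 1) • β)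
    else
      ∑ r ∈ Finset.range (-corootPairing β μ).toNat, mono p ((μ, 0) + (r : ℤ) • β)

open Classical in
/-- The numerator of `v_β`: for a long root `β`,
`(1 - t_β t_{β/2} x^{β/2}) (1 + t_β t_{β/2}⁻¹ x^{β/2})`, where `x^{β/2} = (q^{1/2})^m x^{α/2}` for
`β = α + m δ`; for a medium root, where `t_{β/2} = 1`, this is `1 - t_β² x^β`. -/
def vNum {n : ℕ} (p : Params) (β : AffLat n) : Laurent n :=
  if IsLong β.1 then
    (1 - AddMonoidAlgebra.single (fun k => β.1 k / 2)
        ((p.mult β * p.multHalf β * p.qh ^ β.2 : ℂˣ) : ℂ)) *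
      (1 + AddMonoidAlgebra.single (fun k => β.1 k / 2)
        ((p.mult β * (p.multHalf β)⁻¹ * p.qh ^ β.2 : ℂˣ) : ℂ))
  else 1 - (((p.mult β) ^ 2 : ℂˣ) : ℂ) • mono p β

/-- The value at `x` of the rational function `v_β = vNum_β / (1 - x^β)`. -/
def v {n : ℕ} (p : Params) (β : AffLat n) (x : Fin n → ℂ) : ℂ :=
  eval x (vNum p β) / eval x (1 - mono p β)

/-- The difference-reflection operator `T_i = t_i + t_i⁻¹ v_{a_i}(x) (s_i - id)` on `𝒜`. -/
def T {n : ℕ} (p : Params) (i : Fin (n + 1)) : Module.End ℂ (Laurent n) :=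
  (p.mult (simpleRoot (n := n) i) : ℂ) • LinearMap.id -
    ((p.mult (simpleRoot (n := n) i) : ℂ)⁻¹) •
      (LinearMap.mulLeft ℂ (vNum p (simpleRoot i)) ∘ₗ divDiff p (simpleRoot i))

/-! ### The `Y`-operators -/

/-- A reduced expression of `τ(v)` in the simple reflections
(there is one, see `exists_isReducedWordFor`). -/
def reducedWord {n : ℕ} (v : Fin n → ℤ) : List (Fin (n + 1)) :=
  Classical.epsilon (IsReducedWordFor v)

/-- `T_{τ(v)} = T_{i_1} ⋯ T_{i_r}` for a reduced expression `τ(v) = s_{i_1} ⋯ s_{i_r}`. -/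
def TTranslation {n : ℕ} (p : Params) (v : Fin n → ℤ) : Module.End ℂ (Laurent n) :=
  ((reducedWord v).map (T p)).prod

/-- The coefficient `⟨λ, a_j^∨⟩` of the fundamental weight `ω_j = ε_1 + ⋯ + ε_j` in `λ`
(`j = k + 1`): `λ_j - λ_{j+1}` for `j < n` and `λ_n` for `j = n`. -/
def fundCoeff {n : ℕ} (l : Fin n → ℤ) (k : Fin n) : ℤ :=
  l k - if h : (k : ℕ) + 1 < n then l ⟨k + 1, h⟩ else 0

/-- The dominant weight `∑_j max(⟨λ, a_j^∨⟩, 0) ω_j`. -/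
def posWeight {n : ℕ} (l : Fin n → ℤ) : Fin n → ℤ :=
  fun i => ∑ k ∈ Finset.Ici i, max (fundCoeff l k) 0

/-- The dominant weight `∑_j max(-⟨λ, a_j^∨⟩, 0) ω_j`, so that `λ = posWeight λ - negWeight λ`. -/
def negWeight {n : ℕ} (l : Fin n → ℤ) : Fin n → ℤ :=
  fun i => ∑ k ∈ Finset.Ici i, max (-fundCoeff l k) 0

/-- `Y^λ = T_{τ(μ)} (T_{τ(ν)})⁻¹`, where `λ = μ - ν` with `μ`, `ν` dominant. Every `T_i` is
invertible, as `(T_i - t_i) (T_i + t_i⁻¹) = 0`. -/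
def Y {n : ℕ} (p : Params) (l : Fin n → ℤ) : Module.End ℂ (Laurent n) :=
  TTranslation p (posWeight l) * Ring.inverse (TTranslation p (negWeight l))

/-- `f(Y) = ∑ c_λ Y^λ` for `f = ∑ c_λ x^λ`. -/
def evalY {n : ℕ} (p : Params) (f : Laurent n) : Module.End ℂ (Laurent n) :=
  f.coeff.sum fun μ z => z • Y p μ

/-! ### The spectrum of the `Y`-operators -/

/-- `1` on non-negative integers, `-1` on negative integers. -/
def sgn (m : ℤ) : ℤ := if 0 ≤ m then 1 else -1

/-- `ρ_l(λ) = ∑ sgn⟨λ, α⟩ α^∨` over the positive long roots `α = 2 ε_i`, `α^∨ = ε_i`. -/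
def rhoL {n : ℕ} (l : Fin n → ℤ) : Fin n → ℤ :=
  ∑ i, sgn (2 * l i) • Pi.single i (1 : ℤ)

/-- `ρ_m(λ) = ∑ sgn⟨λ, α⟩ α^∨` over the positive medium roots `α = α^∨ = ε_i ± ε_j`, `i < j`. -/
def rhoM {n : ℕ} (l : Fin n → ℤ) : Fin n → ℤ :=
  ∑ i, ∑ j ∈ Finset.Ioi i,
    (sgn (l i - l j) • (Pi.single i (1 : ℤ) - Pi.single j 1) +
      sgn (l i + l j) • (Pi.single i (1 : ℤ) + Pi.single j 1))

/-- `γ_λ = t_0^{ρ_l(λ)} t_n^{ρ_l(λ)} t^{ρ_m(λ)} q^λ`, coordinatewise. -/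
def gamma {n : ℕ} (p : Params) (l : Fin n → ℤ) : Fin n → ℂˣ :=
  fun k => p.t0 ^ rhoL l k * p.tn ^ rhoL l k * p.t ^ rhoM l k * p.q ^ l k

/-! ### Non-symmetric Koornwinder polynomials -/

/-- `λ_1 ≥ ⋯ ≥ λ_n ≥ 0`. -/
def IsDominant {n : ℕ} (l : Fin n → ℤ) : Prop := Antitone l ∧ ∀ i, 0 ≤ l i

/-- `λ` and `μ` are in the same orbit of `W`, the group of permutations and sign changes. -/
def SameOrbit {n : ℕ} (l m : Fin n → ℤ) : Prop :=
  ∃ (σ : Equiv.Perm (Fin n)) (s : Fin n → ℤˣ), ∀ i, m i = s i * l (σ i)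

/-- `λ ≤ μ`: `μ - λ` is a sum of simple co-roots `a_i^∨ = ε_i - ε_{i+1}` (`i < n`),
`a_n^∨ = ε_n`. -/
def DomLE {n : ℕ} (l m : Fin n → ℤ) : Prop :=
  ∃ k : Fin n → ℕ, m - l = ∑ i : Fin n,
    (k i : ℤ) • (eps n ((i : ℕ) + 1) - eps n ((i : ℕ) + 2))

/-- `λ ≺ μ`: `λ ≠ μ` and, for the dominant weights `λ⁺`, `μ⁺` in the `W`-orbits, either
`λ⁺ < μ⁺`, or `λ⁺ = μ⁺` and `λ ≤ μ`. -/
def Prec {n : ℕ} (l m : Fin n → ℤ) : Prop :=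
  l ≠ m ∧ ∃ l' m' : Fin n → ℤ, IsDominant l' ∧ SameOrbit l l' ∧ IsDominant m' ∧ SameOrbit m m' ∧
    ((DomLE l' m' ∧ l' ≠ m') ∨ (l' = m' ∧ DomLE l m))

/-- `P` is the monic non-symmetric Koornwinder polynomial `P_λ(·; 𝐭; q)`: it is `x^λ` plus a
combination of the `x^μ` with `μ ≺ λ`, and `f(Y) P = f(γ_λ) P` for all `f ∈ 𝒜`. -/
structure IsMonicKoornwinder {n : ℕ} (p : Params) (l : Fin n → ℤ) (P : Laurent n) : Prop where
  coeff_self : P.coeff l = 1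
  triangular : ∀ m, P.coeff m ≠ 0 → m = l ∨ Prec m l
  eigen : ∀ f : Laurent n, evalY p f P = eval (fun k => (gamma p l k : ℂ)) f • P

/-- `E` is the normalized non-symmetric Koornwinder polynomial `E(γ_λ; ·; 𝐭; q)`: the constant
multiple of `P_λ(·; 𝐭; q)` with value `1` at `x_0⁻¹`, where `x_0` is the point `γ_0` for the dual
parameters. -/
def IsKoornwinderE {n : ℕ} (p : Params) (l : Fin n → ℤ) (E : Laurent n) : Prop :=
  ∃ P : Laurent n, IsMonicKoornwinder p l P ∧ (∃ z : ℂ, E = z • P) ∧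
    eval (fun k => ((gamma p.dual (0 : Fin n → ℤ) k)⁻¹ : ℂ)) E = 1

/-! ### The bilinear form -/

/-- The weight function `Δ(x) = ∏_{β ∈ R⁺} 1 / v_β(x)`. -/
def Delta {n : ℕ} (p : Params) (x : Fin n → ℂ) : ℂ := ∏' β : posRoots n, (v p β.1 x)⁻¹

/-- `f(x) (σ g)(x) Δ(x) (x_1 ⋯ x_n)⁻¹`, where `(σ g)(x) = g(x⁻¹)` for the longest element `σ`
of `W`. -/
def integrand {n : ℕ} (p : Params) (f g : Laurent n) (x : Fin n → ℂ) : ℂ :=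
  eval x f * eval (fun k => (x k)⁻¹) g * Delta p x * ∏ k, (x k)⁻¹

/-- `⟨f, g⟩ = (2πi)⁻ⁿ ∫_{𝕋ⁿ} f(x) (σ g)(x) Δ(x) dx/x`. -/
def pairing {n : ℕ} (p : Params) (f g : Laurent n) : ℂ :=
  ((2 * Real.pi * Complex.I) ^ n)⁻¹ * torusIntegral (integrand p f g) 0 1

/-! ### Facts that justify the definitions -/

theorem linExt_single {n : ℕ} (b : (Fin n → ℤ) → Laurent n) (μ : Fin n → ℤ) (z : ℂ) :
    linExt b (AddMonoidAlgebra.single μ z) = z • b μ := by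
  exact Finsupp.sum_single_index (h := fun μ z => z • b μ) (by simp)

theorem mono_add {n : ℕ} (p : Params) (g h : AffLat n) :
    mono p (g + h) = mono p g * mono p h := by
  simp [mono, AddMonoidAlgebra.single_mul_single, zpow_add]

theorem mono_zero {n : ℕ} (p : Params) : mono p (0 : AffLat n) = 1 := by
  simp [mono, AddMonoidAlgebra.one_def]

theorem telescope {n : ℕ} (p : Params) (g β : AffLat n) (N : ℕ) :
    (1 - mono p β) * ∑ r ∈ Finset.range N, mono p (g + (r : ℤ) • β) =
      mono p g - mono p (g + (N : ℤ) • β) := by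
  induction N with
  | zero => simp
  | succ N ih =>
    rw [Finset.sum_range_succ, mul_add, ih, sub_mul, one_mul, ← mono_add]
    have h : β + (g + (N : ℤ) • β) = g + ((N + 1 : ℕ) : ℤ) • β := by
      push_cast; rw [add_smul, one_smul]; abel
    rw [h]; ring

/-- `divDiff` is the divided difference: `(1 - x^β) · divDiff f = f - s_β f`. -/
theorem mul_divDiff {n : ℕ} (p : Params) (β : AffLat n) (f : Laurent n) :
    (1 - mono p β) * divDiff p β f = f - reflAct p β f := by
  induction f using AddMonoidAlgebra.induction_linear with
  | zero => simp
  | add f g hf hg => rw [map_add, map_add, mul_add, hf, hg]; abel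
  | single μ z =>
    have h1 : (AddMonoidAlgebra.single μ z : Laurent n) = z • mono p (μ, 0) := by
      simp [mono]
    rw [divDiff, reflAct, linExt_single, linExt_single, h1, mul_smul_comm, ← smul_sub]
    congr 1
    set k := corootPairing β μ with hk
    have hr : refl β (μ, 0) = (μ, 0) - k • β := rfl
    rw [hr]
    split_ifs with h0
    · have h2 : ∑ r ∈ Finset.range k.toNat, mono p ((μ, 0) - ((r : ℤ) + 1) • β) =
          ∑ r ∈ Finset.range k.toNat, mono p ((μ, 0) - k • β + (r : ℤ) • β) := by
        rw [← Finset.sum_range_reflect]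
        refine Finset.sum_congr rfl fun r hr => ?_
        have hr' : r < k.toNat := Finset.mem_range.1 hr
        have h3 : ((k.toNat - 1 - r : ℕ) : ℤ) + 1 = k - r := by omega
        rw [h3, sub_smul]
        congr 1
        abel
      rw [h2, mul_neg, telescope, Int.toNat_of_nonneg h0]
      simp
    · rw [telescope, Int.toNat_of_nonneg (by omega), neg_smul, ← sub_eq_add_neg]

/-! Every translation `τ(v)`, `v ∈ Λ`, has a reduced expression. -/

theorem wordAct_append {n : ℕ} (w w' : List (Fin (n + 1))) (g : AffLat n) :
    wordAct (w ++ w') g = wordAct w (wordAct w' g) := by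
  simp [wordAct, List.foldr_append]

theorem dot_eps {n : ℕ} (u : Fin n → ℤ) (i : Fin n) : dot u (eps n (i + 1)) = u i := by
  simp [dot, eps, Fin.val_inj]

theorem eps_eq {n : ℕ} (i : Fin n) : eps n (i + 1) = Pi.single i 1 := by
  funext k
  simp [eps, Pi.single_apply, Fin.val_inj]

theorem dot_single {n : ℕ} (u : Fin n → ℤ) (i : Fin n) (z : ℤ) :
    dot u (Pi.single i z) = u i * z := by
  simp [dot, Pi.single_apply]

theorem dot_sub' {n : ℕ} (u v w : Fin n → ℤ) : dot u (v - w) = dot u v - dot u w := by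
  simp [dot, mul_sub, Finset.sum_sub_distrib]

theorem dot_add' {n : ℕ} (u v w : Fin n → ℤ) : dot (u + v) w = dot u w + dot v w := by
  simp [dot, add_mul, Finset.sum_add_distrib]

/-- The simple reflections `s_i`, `0 < i < n`, permute coordinates. -/
theorem refl_medium {n : ℕ} (i j : Fin n) (hij : i ≠ j) (g : AffLat n) :
    refl (Pi.single i 1 - Pi.single j 1, 0) g = (g.1 ∘ Equiv.swap i j, g.2) := by
  have h1 : corootPairing ((Pi.single i 1 - Pi.single j 1, 0) : AffLat n) g.1 = g.1 i - g.1 j := by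
    simp [corootPairing, dot_sub', dot_single, hij, hij.symm]
  rw [refl, h1]
  ext k
  · simp only [Prod.fst_sub, Prod.smul_fst, Pi.sub_apply, Pi.smul_apply, Pi.single_apply,
      Function.comp, smul_eq_mul, Equiv.swap_apply_def]
    split_ifs <;> simp_all
  · simp

/-- The reflection in the long root `± 2 ε_i + m δ`. -/
theorem refl_long {n : ℕ} (i : Fin n) (z : ℤˣ) (m : ℤ) (g : AffLat n) :
    refl (Pi.single i (2 * (z : ℤ)), m) g =
      (Function.update g.1 i (-g.1 i), g.2 - m * z * g.1 i) := by
  have h1 : corootPairing ((Pi.single i (2 * (z : ℤ)), m) : AffLat n) g.1 = z * g.1 i := by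
    rcases Int.units_eq_one_or z with rfl | rfl <;>
      simp only [corootPairing, dot_single, Pi.single_eq_same] <;> push_cast <;> omega
  rw [refl, h1]
  ext k
  · rcases Int.units_eq_one_or z with rfl | rfl <;> by_cases hk : k = i
    · subst hk; simp; ring
    · simp [hk]
    · subst hk; simp; ring
    · simp [hk]
  · simp; ring

theorem simpleRoot_medium {n : ℕ} (i : ℕ) (h : i + 1 < n) :
    simpleRoot (n := n) ⟨i + 1, by omega⟩ =
      (Pi.single ⟨i, by omega⟩ 1 - Pi.single ⟨i + 1, h⟩ 1, 0) := by
  have h1 := eps_eq (n := n) ⟨i, by omega⟩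
  have h2 := eps_eq (n := n) ⟨i + 1, h⟩
  simp only at h1 h2
  have h3 : i + 1 ≠ n := by omega
  simp [simpleRoot, h1, h2, h3]

theorem simpleRoot_zero {n : ℕ} (hn : 0 < n) :
    simpleRoot (n := n) 0 = (Pi.single ⟨0, hn⟩ (2 * ((-1 : ℤˣ) : ℤ)), 1) := by
  have h1 := eps_eq (n := n) ⟨0, hn⟩
  simp only [zero_add] at h1
  simp only [simpleRoot, Fin.val_zero, if_true, h1]
  ext k <;> simp [Pi.single_apply]

theorem simpleRoot_last {n : ℕ} (hn : 0 < n) :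
    simpleRoot (n := n) (Fin.last n) =
      (Pi.single ⟨n - 1, by omega⟩ (2 * ((1 : ℤˣ) : ℤ)), 0) := by
  have h1 := eps_eq (n := n) ⟨n - 1, by omega⟩
  simp only [Nat.sub_add_cancel hn] at h1
  have h2 : n ≠ 0 := by omega
  simp only [simpleRoot, Fin.val_last, h2, if_false, if_true, h1]
  ext k <;> simp [Pi.single_apply]

theorem exists_word_signChange {n : ℕ} (i : ℕ) (hi : i < n) :
    ∃ w : List (Fin (n + 1)), ∀ g : AffLat n,
      wordAct w g = (Function.update g.1 ⟨i, hi⟩ (-g.1 ⟨i, hi⟩), g.2) := by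
  induction h : n - 1 - i generalizing i with
  | zero =>
    have h1 : i = n - 1 := by omega
    subst h1
    refine ⟨[Fin.last n], fun g => ?_⟩
    change refl (simpleRoot (Fin.last n)) g = _
    rw [simpleRoot_last (by omega), refl_long]
    simp
  | succ k ih =>
    have hi' : i + 1 < n := by omega
    obtain ⟨w, hw⟩ := ih (i + 1) hi' (by omega)
    refine ⟨[⟨i + 1, by omega⟩] ++ w ++ [⟨i + 1, by omega⟩], fun g => ?_⟩
    have hne : (⟨i, hi⟩ : Fin n) ≠ ⟨i + 1, hi'⟩ := by simp
    have hs : ∀ g, wordAct [(⟨i + 1, by omega⟩ : Fin (n + 1))] g =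
        (g.1 ∘ Equiv.swap ⟨i, hi⟩ ⟨i + 1, hi'⟩, g.2) := fun g => by
      rw [← refl_medium _ _ hne, ← simpleRoot_medium i hi']; rfl
    rw [wordAct_append, wordAct_append, hs, hw, hs]
    ext k
    · simp only [Function.comp, Function.update_apply, Equiv.swap_apply_def]
      split_ifs <;> simp_all
    · rfl

theorem exists_isWordFor_single {n : ℕ} (i : ℕ) (hi : i < n) (z : ℤˣ) :
    ∃ w, IsWordFor (Pi.single (⟨i, hi⟩ : Fin n) (z : ℤ)) w := by
  induction i with
  | zero =>
    obtain ⟨w, hw⟩ := exists_word_signChange (n := n) 0 hi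
    have hs : ∀ g, wordAct [(0 : Fin (n + 1))] g =
        (Function.update g.1 ⟨0, hi⟩ (-g.1 ⟨0, hi⟩), g.2 + g.1 ⟨0, hi⟩) := fun g => by
      change refl (simpleRoot 0) g = _
      rw [simpleRoot_zero hi, refl_long]
      simp
    rcases Int.units_eq_one_or z with rfl | rfl
    · refine ⟨w ++ [0], fun g => ?_⟩
      ext k <;> simp [wordAct_append, hs, hw, translation, dot, Pi.single_apply]
    · refine ⟨[0] ++ w, fun g => ?_⟩
      rw [wordAct_append, hs, hw]
      ext k <;> simp [translation, dot, Pi.single_apply]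
  | succ i ih =>
    obtain ⟨w, hw⟩ := ih (by omega)
    refine ⟨[⟨i + 1, by omega⟩] ++ w ++ [⟨i + 1, by omega⟩], fun g => ?_⟩
    have hne : (⟨i, by omega⟩ : Fin n) ≠ ⟨i + 1, hi⟩ := by simp
    have hs : ∀ g, wordAct [(⟨i + 1, by omega⟩ : Fin (n + 1))] g =
        (g.1 ∘ Equiv.swap ⟨i, by omega⟩ ⟨i + 1, hi⟩, g.2) := fun g => by
      rw [← refl_medium _ _ hne, ← simpleRoot_medium i hi]; rfl
    rw [wordAct_append, wordAct_append, hs, hw, hs]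
    ext k <;> simp [translation, dot, Pi.single_apply]

theorem IsWordFor.add {n : ℕ} {v v' : Fin n → ℤ} {w w' : List (Fin (n + 1))}
    (h : IsWordFor v w) (h' : IsWordFor v' w') : IsWordFor (v + v') (w ++ w') := fun g => by
  rw [wordAct_append, h', h]
  ext k
  · rfl
  · simp only [translation, dot_add']; ring

theorem exists_isReducedWordFor {n : ℕ} (v : Fin n → ℤ) : ∃ w, IsReducedWordFor v w := by
  have key : ∃ w, IsWordFor v w := by
    have h0 : ∃ w, IsWordFor (0 : Fin n → ℤ) w :=
      ⟨[], fun g => by ext k <;> simp [wordAct, translation, dot]⟩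
    have h1 : ∀ (i : Fin n) (z : ℤ), ∃ w, IsWordFor (Pi.single i z : Fin n → ℤ) w := by
      intro i z
      induction z using Int.induction_on with
      | zero => simpa using h0
      | succ k ih =>
        obtain ⟨w, hw⟩ := ih
        obtain ⟨w', hw'⟩ := exists_isWordFor_single i.1 i.2 1
        exact ⟨w ++ w', by simpa [Pi.single_add] using hw.add hw'⟩
      | pred k ih =>
        obtain ⟨w, hw⟩ := ih
        obtain ⟨w', hw'⟩ := exists_isWordFor_single i.1 i.2 (-1)
        exact ⟨w ++ w', by simpa [Pi.single_add, sub_eq_add_neg] using hw.add hw'⟩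
    rw [← Finset.univ_sum_single v]
    refine Finset.sum_induction _ (fun u => ∃ w, IsWordFor u w) ?_ h0 fun i _ => h1 i _
    rintro a b ⟨w, hw⟩ ⟨w', hw'⟩
    exact ⟨w ++ w', hw.add hw'⟩
  classical
  have hex : ∃ N, ∃ w, IsWordFor v w ∧ w.length = N := by
    obtain ⟨w, hw⟩ := key
    exact ⟨_, w, hw, rfl⟩
  obtain ⟨w, hw, hl⟩ := Nat.find_spec hex
  exact ⟨w, hw, fun w' hw' => hl ▸ Nat.find_min' hex ⟨w', hw', rfl⟩⟩

theorem isReducedWordFor_reducedWord {n : ℕ} (v : Fin n → ℤ) :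
    IsReducedWordFor v (reducedWord v) :=
  Classical.epsilon_spec (exists_isReducedWordFor v)

end Koornwinder

end

/-! Consider the form (f, g) ↦ ∫ f g Δ over the torus. Each T_i is symmetric for it (`form_T`). In
(T_i f) g - f (T_i g) the factor v_{a_i} cancels the factor of a_i in Δ. The rest of Δ is
s_i-invariant, because s_i permutes the positive roots other than a_i (`refl_simpleRoot_mem`), and
what multiplies it changes sign under s_i. So the integral vanishes once s_i can be used as a change
of variables. For i > 0 it preserves the torus. But s_0 is x_1 ↦ q / x_1, which preserves the circle
|x_1| = |q^{1/2}|; the contour can be moved there since the bounds on the parameters exclude poles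
in between (`eval_vNum_ne_zero_of_annulus`, `integral_circle_eq_zero`). The argument is run for
finite s_i-stable products, and a summable bound for 1 / v_β - 1 carries it to Δ by dominated
convergence.

The inversion of the variables turns T_i for the inverse parameters into T_i⁻¹ (`varInv_T`,
`T_TInv`). Hence the pairing is unchanged when T_w acts on the first argument and its analogue for
the inverse parameters on the second (`form_word_varInv`). For w = τ(ν), ν dominant, the two
polynomials are eigenvectors, with eigenvalues γ_λ^ν and γ_μ^{-ν}. A non-zero pairing would force
γ_λ^ν = γ_μ^ν for all dominant ν, hence γ_λ = γ_μ (`eq_of_monoVal_dominant`).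

It remains that λ ↦ γ_λ is injective (`gamma_injective`). Already the moduli suffice: the logarithms
of the coordinates are signs times heights, and summing the equal heights over the largest entries
at which λ and μ differ gives a contradiction (`eq_of_height_aux`). This uses |t_0 t_n|² q < 1,
which follows from |abcd| < 1. -/

namespace Koornwinder

/-! ### Evaluation of Laurent polynomials -/

/-- The value of the monomial `x^μ`. -/
noncomputable def monoVal {n : ℕ} (x : Fin n → ℂ) (μ : Fin n → ℤ) : ℂ := ∏ k, x k ^ μ k

theorem monoVal_zero {n : ℕ} (x : Fin n → ℂ) : monoVal x 0 = 1 := by simp [monoVal]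

theorem monoVal_add {n : ℕ} {x : Fin n → ℂ} (hx : ∀ k, x k ≠ 0) (μ ν : Fin n → ℤ) :
    monoVal x (μ + ν) = monoVal x μ * monoVal x ν := by
  simp [monoVal, zpow_add₀ (hx _), Finset.prod_mul_distrib]

theorem monoVal_ne_zero {n : ℕ} {x : Fin n → ℂ} (hx : ∀ k, x k ≠ 0) (μ : Fin n → ℤ) :
    monoVal x μ ≠ 0 :=
  Finset.prod_ne_zero_iff.2 fun k _ => zpow_ne_zero _ (hx k)

theorem norm_monoVal {n : ℕ} {x : Fin n → ℂ} (hx : ∀ k, ‖x k‖ = 1) (μ : Fin n → ℤ) :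
    ‖monoVal x μ‖ = 1 := by
  simp [monoVal, hx]

theorem eval_single {n : ℕ} (x : Fin n → ℂ) (μ : Fin n → ℤ) (z : ℂ) :
    eval x (AddMonoidAlgebra.single μ z) = z * monoVal x μ := by
  rw [eval, AddMonoidAlgebra.coeff_single, Finsupp.sum_single_index (by simp), monoVal]

/-- Evaluation at a point with non-zero coordinates, as a homomorphism of algebras. -/
noncomputable def evalHom {n : ℕ} (x : Fin n → ℂ) (hx : ∀ k, x k ≠ 0) : Laurent n →ₐ[ℂ] ℂ :=
  AddMonoidAlgebra.lift ℂ ℂ _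
    { toFun := fun μ => monoVal x μ.toAdd
      map_one' := monoVal_zero x
      map_mul' := fun μ ν => monoVal_add hx μ.toAdd ν.toAdd }

theorem evalHom_apply {n : ℕ} {x : Fin n → ℂ} (hx : ∀ k, x k ≠ 0) (f : Laurent n) :
    evalHom x hx f = eval x f := by
  rw [evalHom, AddMonoidAlgebra.lift_apply]
  rfl

theorem eval_mono {n : ℕ} (p : Params) (x : Fin n → ℂ) (g : AffLat n) :
    eval x (mono p g) = (p.q : ℂ) ^ g.2 * monoVal x g.1 := by
  simp [mono, eval_single]

/-- The inversion of the variables, `x^μ ↦ x^{-μ}`. -/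
noncomputable def varInv {n : ℕ} : Laurent n →ₐ[ℂ] Laurent n :=
  AddMonoidAlgebra.mapDomainAlgHom ℂ ℂ (negAddMonoidHom : (Fin n → ℤ) →+ (Fin n → ℤ))

theorem varInv_single {n : ℕ} (μ : Fin n → ℤ) (z : ℂ) :
    varInv (AddMonoidAlgebra.single μ z) = AddMonoidAlgebra.single (-μ) z := by
  exact AddMonoidAlgebra.mapDomain_single

theorem eval_varInv {n : ℕ} {x : Fin n → ℂ} (hx : ∀ k, x k ≠ 0) (f : Laurent n) :
    eval x (varInv f) = eval (fun k => (x k)⁻¹) f := by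
  have hx' : ∀ k, (x k)⁻¹ ≠ 0 := fun k => inv_ne_zero (hx k)
  induction f using AddMonoidAlgebra.induction_linear with
  | zero => simp [← evalHom_apply hx, ← evalHom_apply hx']
  | add f g hf hg =>
    simp only [← evalHom_apply hx, ← evalHom_apply hx'] at *
    rw [map_add, map_add, map_add, hf, hg]
  | single μ z => simp [varInv_single, eval_single, monoVal]

/-! ### Reflections and divided differences -/

theorem reflAct_single {n : ℕ} (p : Params) (β : AffLat n) (μ : Fin n → ℤ) (z : ℂ) :
    reflAct p β (AddMonoidAlgebra.single μ z) = z • mono p (refl β (μ, 0)) :=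
  linExt_single _ _ _

theorem mono_mul_mono_neg {n : ℕ} (p : Params) (g : AffLat n) : mono p g * mono p (-g) = 1 := by
  rw [← mono_add, add_neg_cancel, mono_zero]

/-- The half of a long root. -/
theorem half_add_half {n : ℕ} {α : Fin n → ℤ} (hα : IsLong α) :
    (fun k => α k / 2) + (fun k => α k / 2) = α := by
  obtain ⟨i, rfl | rfl⟩ := hα <;> ext k <;> by_cases hk : k = i <;> simp [hk]

theorem reflAct_mono {n : ℕ} (p : Params) (β g : AffLat n) :
    reflAct p β (mono p g) = mono p (refl β g) := by
  have h1 : refl β g = refl β (g.1, 0) + (0, g.2) := by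
    ext <;> simp [refl]; ring
  rw [mono, reflAct_single, h1, mono_add, mul_comm]
  simp [mono, AddMonoidAlgebra.single_mul_single]

/-- `β` behaves like a root: its coroot pairing is additive and takes the value `2` at `β`. -/
structure IsReflRoot {n : ℕ} (β : AffLat n) : Prop where
  add : ∀ μ ν : Fin n → ℤ, corootPairing β (μ + ν) = corootPairing β μ + corootPairing β ν
  self : corootPairing β β.1 = 2

namespace IsReflRoot

variable {n : ℕ} {β : AffLat n}

theorem refl_add (h : IsReflRoot β) (g g' : AffLat n) :
    refl β (g + g') = refl β g + refl β g' := by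
  simp only [refl, Prod.fst_add, h.add, add_smul]
  abel

theorem pairing_zero (h : IsReflRoot β) : corootPairing β 0 = 0 := by
  have := h.add 0 0
  simp only [add_zero] at this
  omega

theorem pairing_neg (h : IsReflRoot β) (μ : Fin n → ℤ) :
    corootPairing β (-μ) = -corootPairing β μ := by
  have := h.add μ (-μ)
  rw [add_neg_cancel, h.pairing_zero] at this
  omega

theorem pairing_zsmul (h : IsReflRoot β) (μ : Fin n → ℤ) (k : ℤ) :
    corootPairing β (k • μ) = k * corootPairing β μ := by
  let F : (Fin n → ℤ) →+ ℤ := AddMonoidHom.mk' (corootPairing β) h.add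
  exact (map_zsmul F k μ).trans (by simp [F])

theorem refl_refl (h : IsReflRoot β) (g : AffLat n) : refl β (refl β g) = g := by
  have h1 : corootPairing β (refl β g).1 = -corootPairing β g.1 := by
    have : (refl β g).1 = g.1 + -(corootPairing β g.1 • β.1) := by
      simp [refl, sub_eq_add_neg]
    rw [this, h.add, h.pairing_neg, h.pairing_zsmul, h.self]
    ring
  rw [refl, h1, refl, neg_smul]
  abel

theorem refl_self (h : IsReflRoot β) : refl β β = -β := by
  rw [refl, h.self, two_smul]
  abel

theorem one_sub_mono_ne_zero (h : IsReflRoot β) (p : Params) : (1 : Laurent n) - mono p β ≠ 0 := by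
  intro h0
  have hβ : β.1 ≠ 0 := fun h1 => by
    have := h.self
    rw [h1, h.pairing_zero] at this
    omega
  have h2 := congrArg (fun f : Laurent n => f.coeff 0) h0
  simp [mono, AddMonoidAlgebra.one_def, AddMonoidAlgebra.coeff_single, hβ] at h2

theorem reflAct_mul (h : IsReflRoot β) (p : Params) (f g : Laurent n) :
    reflAct p β (f * g) = reflAct p β f * reflAct p β g := by
  induction f using AddMonoidAlgebra.induction_linear with
  | zero => simp
  | add f f' hf hf' => rw [add_mul, map_add, map_add, add_mul, hf, hf']
  | single μ z =>
    induction g using AddMonoidAlgebra.induction_linear with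
    | zero => simp
    | add f f' hf hf' => rw [mul_add, map_add, map_add, mul_add, hf, hf']
    | single ν w =>
      rw [AddMonoidAlgebra.single_mul_single, reflAct_single, reflAct_single,
        reflAct_single, smul_mul_smul_comm, ← mono_add, ← h.refl_add]
      simp

theorem reflAct_one (h : IsReflRoot β) (p : Params) : reflAct p β (1 : Laurent n) = 1 := by
  rw [← mono_zero p, reflAct_mono, refl]
  simp [h.pairing_zero]

theorem reflAct_reflAct (h : IsReflRoot β) (p : Params) (f : Laurent n) :
    reflAct p β (reflAct p β f) = f := by
  induction f using AddMonoidAlgebra.induction_linear with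
  | zero => simp
  | add f f' hf hf' => rw [map_add, map_add, hf, hf']
  | single μ z =>
    rw [reflAct_single, map_smul, reflAct_mono, h.refl_refl]
    simp [mono]

/-- In (f - s_β f) / (1 - x^β) the reflection changes the sign of the numerator and turns the
denominator into 1 - x^{-β} = -x^{-β} (1 - x^β). As in the other identities for `divDiff`, the
division is avoided by cancelling the non-zero factor 1 - x^β. -/
theorem reflAct_divDiff (h : IsReflRoot β) (p : Params) (f : Laurent n) :
    reflAct p β (divDiff p β f) = mono p β * divDiff p β f := by
  have h1 := mul_divDiff p β f
  have h2 := congrArg (reflAct p β) h1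
  rw [h.reflAct_mul, map_sub, map_sub, h.reflAct_one, reflAct_mono, h.refl_self,
    h.reflAct_reflAct] at h2
  have h3 := mono_mul_mono_neg p β
  refine mul_left_cancel₀ (h.one_sub_mono_ne_zero p) ?_
  linear_combination -(mono p β) * h2 - mono p β * h1 -
    (reflAct p β (divDiff p β f)) * h3

/-- This is v_β + s_β v_β = 1 + t_β², cleared of denominators. -/
theorem vNum_sub (h : IsReflRoot β) (p : Params) :
    vNum p β - mono p β * reflAct p β (vNum p β) =
      (1 + ((p.mult β : ℂ) ^ 2)) • (1 - mono p β) := by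
  have h3 := mono_mul_mono_neg p β
  by_cases hl : IsLong β.1
  · set η : Fin n → ℤ := fun k => β.1 k / 2 with hη
    have hη2 : η + η = β.1 := half_add_half hl
    have hp : corootPairing β η = 1 := by
      have h4 := h.add η η
      have h5 := h.self
      rw [hη2] at h4
      omega
    set Y : Laurent n := AddMonoidAlgebra.single η ((p.qh ^ β.2 : ℂˣ) : ℂ) with hY
    have hq : ((p.q ^ β.2 : ℂˣ) : ℂ) = ((p.qh ^ β.2 : ℂˣ) : ℂ) * ((p.qh ^ β.2 : ℂˣ) : ℂ) := by
      rw [← Units.val_mul, Params.q, pow_two, mul_zpow]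
    have hYY : Y * Y = mono p β := by
      rw [hY, AddMonoidAlgebra.single_mul_single, hη2, mono, hq]
    have hsY : Y * reflAct p β Y = 1 := by
      rw [hY, reflAct_single, refl, hp, one_smul, mono, mul_smul_comm,
        AddMonoidAlgebra.single_mul_single, AddMonoidAlgebra.smul_single, AddMonoidAlgebra.one_def]
      congr 1
      · simp only [Prod.fst_sub]
        rw [← hη2]; abel
      · have : ((0 : ℤ) - β.2) = -β.2 := by ring
        simp only [Prod.snd_sub, this, zpow_neg, Units.val_inv_eq_inv_val, hq, smul_eq_mul]
        field_simp
    have hN : vNum p β = (1 - ((p.mult β * p.multHalf β : ℂˣ) : ℂ) • Y) *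
        (1 + ((p.mult β * (p.multHalf β)⁻¹ : ℂˣ) : ℂ) • Y) := by
      rw [vNum, if_pos hl, hY, AddMonoidAlgebra.smul_single, AddMonoidAlgebra.smul_single]
      simp only [Units.val_mul, smul_eq_mul, hη]
    set A : ℂ := ((p.mult β * p.multHalf β : ℂˣ) : ℂ) with hA
    set B : ℂ := ((p.mult β * (p.multHalf β)⁻¹ : ℂˣ) : ℂ) with hB
    have hAB : (p.mult β : ℂ) ^ 2 = A * B := by
      rw [hA, hB]; simp only [Units.val_mul, Units.val_inv_eq_inv_val]; field_simp
    rw [hAB, hN, h.reflAct_mul, map_sub, map_add, map_smul, map_smul, h.reflAct_one]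
    simp only [Algebra.smul_def, map_add, map_mul, map_one]
    rw [← hYY]
    generalize reflAct p β Y = Z at *
    generalize algebraMap ℂ (Laurent n) A = a
    generalize algebraMap ℂ (Laurent n) B = b
    linear_combination (-(b - a) * Y + a * b * (Y * Z + 1)) * hsY
  · rw [vNum, if_neg hl, map_sub, map_smul, h.reflAct_one, reflAct_mono, h.refl_self]
    simp only [Algebra.smul_def, map_add, map_one, Units.val_pow_eq_pow_val]
    linear_combination (algebraMap ℂ (Laurent n) ((p.mult β : ℂ) ^ 2)) * h3

/-- The quadratic Hecke relation: t_β⁻¹ times multiplication by `vNum` after `divDiff` is t_β - T,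
and this lemma says that it has the eigenvalues 0 and t_β + t_β⁻¹ only. -/
theorem divDiff_vNum_mul (h : IsReflRoot β) (p : Params) (f : Laurent n) :
    divDiff p β (vNum p β * divDiff p β f) = (1 + ((p.mult β : ℂ) ^ 2)) • divDiff p β f := by
  refine mul_left_cancel₀ (h.one_sub_mono_ne_zero p) ?_
  rw [mul_divDiff, h.reflAct_mul, h.reflAct_divDiff]
  have := h.vNum_sub p
  simp only [Algebra.smul_def] at *
  linear_combination (divDiff p β f) * this

end IsReflRoot

/-! ### The quadratic relation and the inverse parameters -/

/-- `T_i - (t_i - t_i⁻¹)`, the inverse of `T_i`. -/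
noncomputable def TInv {n : ℕ} (p : Params) (i : Fin (n + 1)) : Module.End ℂ (Laurent n) :=
  T p i - ((p.mult (simpleRoot (n := n) i) : ℂ) - (p.mult (simpleRoot (n := n) i) : ℂ)⁻¹) •
    LinearMap.id

theorem T_apply {n : ℕ} (p : Params) (i : Fin (n + 1)) (f : Laurent n) :
    T p i f = (p.mult (simpleRoot (n := n) i) : ℂ) • f - (p.mult (simpleRoot (n := n) i) : ℂ)⁻¹ •
      (vNum p (simpleRoot i) * divDiff p (simpleRoot i) f) := rfl

theorem T_TInv {n : ℕ} (p : Params) (i : Fin (n + 1))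
    (h : IsReflRoot (simpleRoot (n := n) i)) (f : Laurent n) : T p i (TInv p i f) = f := by
  have h1 := h.divDiff_vNum_mul p f
  set β := simpleRoot (n := n) i with hβ
  have ht : (p.mult β : ℂ) ≠ 0 := Units.ne_zero _
  have h2 : TInv p i f = (p.mult β : ℂ)⁻¹ • f - (p.mult β : ℂ)⁻¹ • (vNum p β * divDiff p β f) := by
    rw [TInv, LinearMap.sub_apply, T_apply, LinearMap.smul_apply, LinearMap.id_apply, ← hβ]
    module
  rw [h2, T_apply, ← hβ, map_sub, map_smul, map_smul, h1, mul_sub, mul_smul_comm, mul_smul_comm,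
    mul_smul_comm]
  match_scalars <;> field_simp
  ring

theorem Params.mult_inv {n : ℕ} (p : Params) (β : AffLat n) : p.inv.mult β = (p.mult β)⁻¹ := by
  simp only [Params.mult, Params.inv]
  split_ifs <;> rfl

theorem Params.multHalf_inv {n : ℕ} (p : Params) (β : AffLat n) :
    p.inv.multHalf β = (p.multHalf β)⁻¹ := by
  simp only [Params.multHalf, Params.inv]
  split_ifs <;> rfl

theorem Params.q_inv (p : Params) : p.inv.q = p.q⁻¹ := by
  simp [Params.q, Params.inv]

theorem varInv_mono {n : ℕ} (p : Params) (g : AffLat n) :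
    varInv (mono p.inv g) = mono p (-g) := by
  simp [mono, varInv_single, Params.q_inv]

theorem varInv_reflAct {n : ℕ} (p : Params) {β : AffLat n} (h : IsReflRoot β) (f : Laurent n) :
    varInv (reflAct p.inv β f) = reflAct p β (varInv f) := by
  induction f using AddMonoidAlgebra.induction_linear with
  | zero => simp
  | add f f' hf hf' => simp only [map_add, hf, hf']
  | single μ z =>
    rw [reflAct_single, map_smul, varInv_mono, varInv_single, reflAct_single]
    congr 2
    ext <;> simp [refl, h.pairing_neg]; ring

/-- Inversion commutes with s_β and sends x^β for the inverse parameters to x^{-β}, so only the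
denominator changes: 1 / (1 - x^{-β}) = -x^β / (1 - x^β). -/
theorem varInv_divDiff {n : ℕ} (p : Params) {β : AffLat n} (h : IsReflRoot β) (f : Laurent n) :
    varInv (divDiff p.inv β f) = -(mono p β * divDiff p β (varInv f)) := by
  have h1 := congrArg varInv (mul_divDiff p.inv β f)
  rw [map_mul, map_sub, map_sub, map_one, varInv_mono, varInv_reflAct p h, ← mul_divDiff] at h1
  have h3 := mono_mul_mono_neg p β
  refine mul_left_cancel₀ (h.one_sub_mono_ne_zero p) ?_
  linear_combination -(mono p β) * h1 - (varInv (divDiff p.inv β f)) * h3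

/-- Cleared of denominators: v_β for the inverse parameters, taken at x⁻¹, is t_β⁻² v_β(x). -/
theorem varInv_vNum {n : ℕ} (p : Params) (β : AffLat n) :
    ((p.mult β : ℂ) ^ 2) • (mono p β * varInv (vNum p.inv β)) = -vNum p β := by
  have h3 := mono_mul_mono_neg p β
  have ht : (p.mult β : ℂ) ≠ 0 := Units.ne_zero _
  by_cases hl : IsLong β.1
  · rw [vNum, vNum, if_pos hl, if_pos hl]
    set η : Fin n → ℤ := fun k => β.1 k / 2 with hη
    have hη2 : η + η = β.1 := half_add_half hl
    set Y : Laurent n := AddMonoidAlgebra.single η ((p.qh ^ β.2 : ℂˣ) : ℂ) with hY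
    set Z : Laurent n := AddMonoidAlgebra.single (-η) (((p.qh ^ β.2)⁻¹ : ℂˣ) : ℂ) with hZ
    have hYY : mono p β = Y * Y := by
      rw [hY, AddMonoidAlgebra.single_mul_single, hη2, mono, ← Units.val_mul, Params.q, pow_two,
        mul_zpow]
    have hYZ : Y * Z = 1 := by
      rw [hY, hZ, AddMonoidAlgebra.single_mul_single, ← Units.val_mul]
      simp [AddMonoidAlgebra.one_def]
    have e1 : ∀ u : ℂˣ, (AddMonoidAlgebra.single η ((u * p.qh ^ β.2 : ℂˣ) : ℂ) : Laurent n) =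
        (u : ℂ) • Y := fun u => by
      rw [hY, AddMonoidAlgebra.smul_single]; simp
    have e2 : ∀ u : ℂˣ, varInv (AddMonoidAlgebra.single η ((u * p.inv.qh ^ β.2 : ℂˣ) : ℂ)) =
        (u : ℂ) • Z := fun u => by
      rw [hZ, AddMonoidAlgebra.smul_single, varInv_single]; simp [Params.inv]
    rw [map_mul, map_sub, map_add, map_one, e1, e1, e2, e2, Params.mult_inv, Params.multHalf_inv,
      hYY]
    have hu : (p.multHalf β : ℂ) ≠ 0 := Units.ne_zero _
    simp only [Units.val_mul, Units.val_inv_eq_inv_val, inv_inv]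
    have c1 : algebraMap ℂ (Laurent n) (p.mult β : ℂ) *
        algebraMap ℂ (Laurent n) (p.mult β : ℂ)⁻¹ = 1 := by
      rw [← map_mul, mul_inv_cancel₀ ht, map_one]
    have c2 : algebraMap ℂ (Laurent n) (p.multHalf β : ℂ) *
        algebraMap ℂ (Laurent n) (p.multHalf β : ℂ)⁻¹ = 1 := by
      rw [← map_mul, mul_inv_cancel₀ hu, map_one]
    simp only [Algebra.smul_def, map_mul, map_pow]
    generalize algebraMap ℂ (Laurent n) (p.mult β : ℂ) = t at *
    generalize algebraMap ℂ (Laurent n) (p.mult β : ℂ)⁻¹ = t' at *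
    generalize algebraMap ℂ (Laurent n) (p.multHalf β : ℂ) = u at *
    generalize algebraMap ℂ (Laurent n) (p.multHalf β : ℂ)⁻¹ = u' at *
    have d1 : t * Y * (1 - t' * u' * Z) = t * Y - u' := by
      linear_combination (-u' * (t * t')) * hYZ - u' * c1
    have d2 : t * Y * (1 + t' * u * Z) = t * Y + u := by
      linear_combination (u * (t * t')) * hYZ + u * c1
    have d3 : t ^ 2 * (Y * Y * ((1 - t' * u' * Z) * (1 + t' * u * Z))) =
        (t * Y - u') * (t * Y + u) := by
      rw [← d1, ← d2]; ring
    rw [d3]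
    linear_combination (-1 - t ^ 2 * Y ^ 2) * c2
  · rw [vNum, vNum, if_neg hl, if_neg hl, map_sub, map_smul, map_one, varInv_mono, Params.mult_inv]
    have c1 : algebraMap ℂ (Laurent n) ((p.mult β : ℂ) ^ 2) *
        algebraMap ℂ (Laurent n) ((p.mult β : ℂ) ^ 2)⁻¹ = 1 := by
      rw [← map_mul, mul_inv_cancel₀ (pow_ne_zero _ ht), map_one]
    simp only [inv_pow, Units.val_inv_eq_inv_val, Units.val_pow_eq_pow_val, Algebra.smul_def]
    linear_combination (-1 : Laurent n) * c1 - (algebraMap ℂ (Laurent n) ((p.mult β : ℂ) ^ 2) *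
      algebraMap ℂ (Laurent n) ((p.mult β : ℂ) ^ 2)⁻¹) * h3

/-- The factor x^β from `varInv_divDiff` is absorbed by `varInv_vNum`, and t_i · t_i⁻² = t_i⁻¹
restores the coefficient of T_i. Only the scalar term has changed, from t_i to t_i⁻¹, and that is
the shape of T_i⁻¹. -/
theorem varInv_T {n : ℕ} (p : Params) (i : Fin (n + 1))
    (h : IsReflRoot (simpleRoot (n := n) i)) (f : Laurent n) :
    varInv (T p.inv i f) = TInv p i (varInv f) := by
  set β := simpleRoot (n := n) i with hβ
  have ht : (p.mult β : ℂ) ≠ 0 := Units.ne_zero _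
  have h2 : TInv p i (varInv f) = (p.mult β : ℂ)⁻¹ • varInv f -
      (p.mult β : ℂ)⁻¹ • (vNum p β * divDiff p β (varInv f)) := by
    rw [TInv, LinearMap.sub_apply, T_apply, LinearMap.smul_apply, LinearMap.id_apply, ← hβ]
    module
  rw [h2, T_apply, map_sub, map_smul, map_smul, map_mul, ← hβ, varInv_divDiff p h,
    Params.mult_inv, Units.val_inv_eq_inv_val, inv_inv]
  congr 1
  have h4 := varInv_vNum p β
  have h5 : vNum p β = -(((p.mult β : ℂ) ^ 2) • (mono p β * varInv (vNum p.inv β))) := by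
    rw [h4, neg_neg]
  rw [h5]
  simp only [neg_mul, smul_mul_assoc, smul_neg, smul_smul, mul_neg]
  congr 1
  rw [show (p.mult β : ℂ)⁻¹ * (p.mult β : ℂ) ^ 2 = p.mult β by field_simp]
  congr 1
  ring

/-! ### The simple reflections in coordinates -/

theorem pairing_medium {n : ℕ} {i j : Fin n} (hij : i ≠ j) (μ : Fin n → ℤ) :
    corootPairing ((Pi.single i 1 - Pi.single j 1, 0) : AffLat n) μ = μ i - μ j := by
  simp [corootPairing, dot_sub', dot_single, hij, hij.symm]

theorem pairing_long {n : ℕ} (i : Fin n) (z : ℤˣ) (m : ℤ) (μ : Fin n → ℤ) :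
    corootPairing ((Pi.single i (2 * (z : ℤ)), m) : AffLat n) μ = z * μ i := by
  rcases Int.units_eq_one_or z with rfl | rfl <;>
    simp only [corootPairing, dot_single, Pi.single_eq_same] <;> push_cast <;> omega

theorem isReflRoot_medium {n : ℕ} {i j : Fin n} (hij : i ≠ j) :
    IsReflRoot ((Pi.single i 1 - Pi.single j 1, 0) : AffLat n) where
  add μ ν := by simp only [pairing_medium hij, Pi.add_apply]; ring
  self := by simp [pairing_medium hij, hij, hij.symm]

theorem isReflRoot_long {n : ℕ} (i : Fin n) (z : ℤˣ) (m : ℤ) :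
    IsReflRoot ((Pi.single i (2 * (z : ℤ)), m) : AffLat n) where
  add μ ν := by simp only [pairing_long, Pi.add_apply]; ring
  self := by
    rw [pairing_long]
    rcases Int.units_eq_one_or z with rfl | rfl <;> simp

/-- A simple root is one of `δ - 2 ε_1`, `ε_i - ε_{i+1}`, `2 ε_n`. -/
theorem simpleRoot_cases {n : ℕ} (hn : 0 < n) (i : Fin (n + 1)) :
    simpleRoot (n := n) i = (Pi.single ⟨0, hn⟩ (2 * ((-1 : ℤˣ) : ℤ)), 1) ∨
    simpleRoot (n := n) i = (Pi.single ⟨n - 1, by omega⟩ (2 * ((1 : ℤˣ) : ℤ)), 0) ∨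
    ∃ a b : Fin n, (b : ℕ) = a + 1 ∧ simpleRoot i = (Pi.single a 1 - Pi.single b 1, 0) := by
  obtain ⟨i, hi⟩ := i
  rcases Nat.eq_zero_or_pos i with rfl | h0
  · exact .inl (simpleRoot_zero hn)
  · rcases eq_or_ne i n with rfl | h1
    · exact .inr (.inl (simpleRoot_last hn))
    · obtain ⟨j, rfl⟩ := Nat.exists_eq_succ_of_ne_zero h0.ne'
      have h2 : j + 1 < n := by omega
      exact .inr (.inr ⟨⟨j, by omega⟩, ⟨j + 1, h2⟩, rfl, simpleRoot_medium j h2⟩)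

theorem isReflRoot_simpleRoot {n : ℕ} (hn : 0 < n) (i : Fin (n + 1)) :
    IsReflRoot (simpleRoot (n := n) i) := by
  rcases simpleRoot_cases hn i with h | h | ⟨a, b, hab, h⟩ <;> rw [h]
  · exact isReflRoot_long _ _ _
  · exact isReflRoot_long _ _ _
  · exact isReflRoot_medium fun e => by rw [e] at hab; omega

/-! ### Roots under permutations and sign changes -/

theorem single_comp_swap {n : ℕ} (a b i : Fin n) (z : ℤ) :
    (Pi.single i z : Fin n → ℤ) ∘ Equiv.swap a b = Pi.single (Equiv.swap a b i) z := by
  ext k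
  simp only [Function.comp, Pi.single_apply]
  congr 1
  rw [eq_iff_iff]
  constructor
  · rintro rfl; simp
  · rintro rfl; simp

theorem IsLong.comp_swap {n : ℕ} {α : Fin n → ℤ} (h : IsLong α) (a b : Fin n) :
    IsLong (α ∘ Equiv.swap a b) := by
  obtain ⟨i, rfl | rfl⟩ := h
  · exact ⟨Equiv.swap a b i, .inl (single_comp_swap _ _ _ _)⟩
  · exact ⟨Equiv.swap a b i, .inr (by rw [← single_comp_swap]; rfl)⟩

theorem comp_swap_comp_swap {n : ℕ} {X : Type*} (α : Fin n → X) (a b : Fin n) :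
    (α ∘ Equiv.swap a b) ∘ Equiv.swap a b = α := by
  ext; simp

theorem isLong_comp_swap {n : ℕ} {α : Fin n → ℤ} (a b : Fin n) :
    IsLong (α ∘ Equiv.swap a b) ↔ IsLong α :=
  ⟨fun h => by simpa only [comp_swap_comp_swap] using h.comp_swap a b, fun h => h.comp_swap a b⟩

theorem IsMedium.comp_swap {n : ℕ} {α : Fin n → ℤ} (h : IsMedium α) (a b : Fin n) :
    IsMedium (α ∘ Equiv.swap a b) := by
  obtain ⟨i, j, hij, r, s, rfl⟩ := h
  have e : (Pi.single i (r : ℤ) + Pi.single j (s : ℤ) : Fin n → ℤ) ∘ Equiv.swap a b =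
      Pi.single (Equiv.swap a b i) (r : ℤ) + Pi.single (Equiv.swap a b j) (s : ℤ) := by
    rw [← single_comp_swap, ← single_comp_swap]; rfl
  rw [e]
  rcases lt_trichotomy (Equiv.swap a b i) (Equiv.swap a b j) with h | h | h
  · exact ⟨_, _, h, r, s, rfl⟩
  · exact absurd ((Equiv.swap a b).injective h) hij.ne
  · exact ⟨_, _, h, s, r, add_comm _ _⟩

/-- Exchanging two adjacent labels reverses the order of no other pair, so ε_a - ε_b is the only
positive gradient that can become negative. -/
theorem IsPosGradient.comp_swap {n : ℕ} {α : Fin n → ℤ} (h : IsPosGradient α) {a b : Fin n}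
    (hab : (b : ℕ) = a + 1) (hα : α ≠ Pi.single a 1 - Pi.single b 1) :
    IsPosGradient (α ∘ Equiv.swap a b) := by
  rcases h with ⟨i, rfl⟩ | ⟨i, j, hij, s, rfl⟩
  · exact .inl ⟨_, single_comp_swap _ _ _ _⟩
  · have e : (Pi.single i 1 + Pi.single j (s : ℤ) : Fin n → ℤ) ∘ Equiv.swap a b =
        Pi.single (Equiv.swap a b i) 1 + Pi.single (Equiv.swap a b j) (s : ℤ) := by
      rw [← single_comp_swap, ← single_comp_swap]; rfl
    rw [e]
    by_cases h1 : Equiv.swap a b i < Equiv.swap a b j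
    · exact .inr ⟨_, _, h1, s, rfl⟩
    · have h2 : i = a ∧ j = b := by
        simp only [Equiv.swap_apply_def, not_lt, Fin.le_def] at h1
        simp only [Fin.lt_def] at hij
        simp only [Fin.ext_iff] at h1 ⊢
        split_ifs at h1 <;> omega
      obtain ⟨rfl, rfl⟩ := h2
      rcases Int.units_eq_one_or s with rfl | rfl
      · exact .inr ⟨i, j, hij, 1, by simp [add_comm]⟩
      · exact absurd (by simp [sub_eq_add_neg, ← Pi.single_neg]) hα

/-- Change of the sign of the `k`-th coordinate. -/
def signChange {n : ℕ} (k : Fin n) (α : Fin n → ℤ) : Fin n → ℤ := Function.update α k (-α k)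

theorem signChange_signChange {n : ℕ} (k : Fin n) (α : Fin n → ℤ) :
    signChange k (signChange k α) = α := by
  simp [signChange]

theorem signChange_single_self {n : ℕ} (k : Fin n) (z : ℤ) :
    signChange k (Pi.single k z) = Pi.single k (-z) := by
  ext l; by_cases h : l = k <;> simp [signChange, h]

theorem signChange_single_of_ne {n : ℕ} {k i : Fin n} (h : i ≠ k) (z : ℤ) :
    signChange k (Pi.single i z) = Pi.single i z := by
  simp [signChange, h.symm]

theorem signChange_add {n : ℕ} (k : Fin n) (α β : Fin n → ℤ) :
    signChange k (α + β) = signChange k α + signChange k β := by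
  ext l; by_cases h : l = k
  · subst h; simp [signChange]; ring
  · simp [signChange, h]

theorem exists_signChange_single {n : ℕ} (k i : Fin n) (r : ℤˣ) :
    ∃ r' : ℤˣ, ∀ z : ℤ, signChange k (Pi.single i (r * z)) = Pi.single i (r' * z) := by
  by_cases h : i = k
  · subst h; exact ⟨-r, fun z => by rw [signChange_single_self]; simp⟩
  · exact ⟨r, fun z => signChange_single_of_ne h _⟩

theorem isLong_iff {n : ℕ} {α : Fin n → ℤ} :
    IsLong α ↔ ∃ (i : Fin n) (r : ℤˣ), α = Pi.single i ((r : ℤ) * 2) := by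
  refine exists_congr fun i => ?_
  constructor
  · rintro (rfl | rfl)
    · exact ⟨1, by simp⟩
    · exact ⟨-1, by simp [← Pi.single_neg]⟩
  · rintro ⟨r, rfl⟩
    rcases Int.units_eq_one_or r with rfl | rfl
    · exact .inl (by simp)
    · exact .inr (by simp [← Pi.single_neg])

theorem IsLong.signChange {n : ℕ} {α : Fin n → ℤ} (h : IsLong α) (k : Fin n) :
    IsLong (signChange k α) := by
  obtain ⟨i, r, rfl⟩ := isLong_iff.1 h
  obtain ⟨r', h'⟩ := exists_signChange_single k i r
  exact isLong_iff.2 ⟨i, r', h' 2⟩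

theorem isLong_signChange {n : ℕ} {α : Fin n → ℤ} (k : Fin n) :
    IsLong (signChange k α) ↔ IsLong α :=
  ⟨fun h => by simpa only [signChange_signChange] using h.signChange k, fun h => h.signChange k⟩

theorem IsMedium.signChange {n : ℕ} {α : Fin n → ℤ} (h : IsMedium α) (k : Fin n) :
    IsMedium (signChange k α) := by
  obtain ⟨i, j, hij, r, s, rfl⟩ := h
  obtain ⟨r', hr⟩ := exists_signChange_single k i r
  obtain ⟨s', hs⟩ := exists_signChange_single k j s
  have hr := hr 1
  have hs := hs 1
  simp only [mul_one] at hr hs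
  exact ⟨i, j, hij, r', s', by rw [signChange_add, hr, hs]⟩

theorem IsLong.even_apply {n : ℕ} {α : Fin n → ℤ} (h : IsLong α) (k : Fin n) : Even (α k) := by
  obtain ⟨i, r, rfl⟩ := isLong_iff.1 h
  by_cases hk : k = i <;> simp [hk]

/-! ### Simple reflections permute the other positive roots -/

theorem refl_swap_mem {n : ℕ} {a b : Fin n} (hab : (b : ℕ) = a + 1) {β γ : AffLat n}
    (hβ : β = (Pi.single a 1 - Pi.single b 1, 0)) (hγ : γ ∈ posRoots n) (hne : γ ≠ β) :
    refl β γ ∈ posRoots n := by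
  subst hβ
  rw [refl_medium a b (fun e => by rw [e] at hab; omega)]
  refine ⟨hγ.1.imp (fun h => h.comp_swap a b) (fun h => h.comp_swap a b),
    hγ.2.imp id fun h => ⟨h.1, h.2.comp_swap hab fun e => hne ?_⟩⟩
  exact Prod.ext e h.1

theorem refl_last_mem {n : ℕ} {k : Fin n} (hk : ∀ i, i ≤ k) {β γ : AffLat n}
    (hβ : β = (Pi.single k (2 * ((1 : ℤˣ) : ℤ)), 0)) (hγ : γ ∈ posRoots n) (hne : γ ≠ β) :
    refl β γ ∈ posRoots n := by
  subst hβ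
  rw [refl_long]
  refine ⟨hγ.1.imp (fun h => h.signChange k) (fun h => h.signChange k), ?_⟩
  refine hγ.2.imp (fun h => by simpa using h) fun h => ⟨by simpa using h.1, ?_⟩
  change IsPosGradient (signChange k γ.1)
  rcases h.2 with ⟨i, hi⟩ | ⟨i, j, hij, s, hi⟩
  · have : i ≠ k := fun e => hne (Prod.ext (by simp [hi, e]) h.1)
    exact .inl ⟨i, by rw [hi, signChange_single_of_ne this]⟩
  · have hik : i ≠ k := fun e => absurd hij (by rw [e]; exact not_lt.2 (hk j))
    obtain ⟨s', hs⟩ := exists_signChange_single k j s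
    have hs := hs 1
    simp only [mul_one] at hs
    exact .inr ⟨i, j, hij, s', by rw [hi, signChange_add, hs, signChange_single_of_ne hik]⟩

/-- The reflection s_0 adds the first coordinate of the gradient α to the coefficient m of δ. Only
α_1 < 0 is critical; there m > 0. If m + α_1 = 0, the reflected gradient has a positive first
coordinate and is positive. The only root with m + α_1 < 0 is a_0 itself. -/
theorem refl_zero_mem {n : ℕ} {k : Fin n} (hk : ∀ i, k ≤ i) {β γ : AffLat n}
    (hβ : β = (Pi.single k (2 * ((-1 : ℤˣ) : ℤ)), 1)) (hγ : γ ∈ posRoots n) (hne : γ ≠ β) :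
    refl β γ ∈ posRoots n := by
  subst hβ
  rw [refl_long]
  refine ⟨hγ.1.imp (fun h => h.signChange k) (fun h => h.signChange k), ?_⟩
  change 0 < γ.2 - 1 * (((-1 : ℤˣ)) : ℤ) * γ.1 k ∨ (γ.2 - 1 * (((-1 : ℤˣ)) : ℤ) * γ.1 k = 0 ∧
    IsPosGradient (signChange k γ.1))
  simp only [Units.val_neg, Units.val_one, one_mul, neg_mul, sub_neg_eq_add]
  rcases hγ.1 with h | ⟨i, j, hij, r, s, hi⟩
  · obtain ⟨i, r, hi⟩ := isLong_iff.1 h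
    by_cases hik : i = k
    · subst hik
      have hγk : γ.1 i = r * 2 := by simp [hi]
      rcases Int.units_eq_one_or r with rfl | rfl
      · have h2 : 0 ≤ γ.2 := by rcases hγ.2 with h | h <;> omega
        left; rw [hγk]; push_cast; omega
      · have h1 : γ.2 ≠ 1 := fun e => hne (Prod.ext (by rw [hi]; simp) e)
        have h2 : 0 < γ.2 := by
          rcases hγ.2 with h | ⟨-, h⟩
          · exact h
          · exfalso
            rcases h with ⟨i', h⟩ | ⟨i', j', hij, s, h⟩
            · have := congrFun h i
              rw [hγk] at this
              by_cases e : i = i' <;> simp [e] at this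
            · have := congrFun h i
              rw [hγk] at this
              by_cases e : i = i' <;> by_cases e' : i = j' <;>
                rcases Int.units_eq_one_or s with rfl | rfl <;>
                simp [e, e', hij.ne, hij.ne'] at this
        rcases (show γ.2 = 2 ∨ 2 < γ.2 by omega) with h3 | h3
        · right
          refine ⟨by rw [hγk, h3]; simp, .inl ⟨i, ?_⟩⟩
          rw [hi, signChange_single_self]; simp
        · left; rw [hγk]; push_cast; omega
    · have hγk : γ.1 k = 0 := by rw [hi]; simp [Ne.symm hik]
      have : signChange k γ.1 = γ.1 := by rw [hi, signChange_single_of_ne hik]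
      rw [hγk, this, add_zero]
      exact hγ.2
  · have hjk : j ≠ k := fun e => absurd hij (by rw [e]; exact not_lt.2 (hk i))
    by_cases hik : i = k
    · subst hik
      have hγk : γ.1 i = r := by simp [hi, hij.ne]
      rcases Int.units_eq_one_or r with rfl | rfl
      · have h2 : 0 ≤ γ.2 := by rcases hγ.2 with h | h <;> omega
        left; rw [hγk]; push_cast; omega
      · have h2 : 0 < γ.2 := by
          rcases hγ.2 with h | ⟨-, h⟩
          · exact h
          · exfalso
            rcases h with ⟨i', h⟩ | ⟨i', j', hij', s', h⟩
            · have := congrFun h i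
              rw [hγk] at this
              by_cases e : i = i' <;> simp [e] at this
            · have h5 := congrFun h i
              rw [hγk] at h5
              have hij2 : i ≠ j' := fun e => absurd hij' (by rw [← e]; exact not_lt.2 (hk i'))
              by_cases e : i = i' <;> simp [e, hij2, hij'.ne] at h5
        rcases (show γ.2 = 1 ∨ 1 < γ.2 by omega) with h3 | h3
        · right
          refine ⟨by rw [hγk, h3]; simp, .inr ⟨i, j, hij, s, ?_⟩⟩
          rw [hi, signChange_add, signChange_single_self, signChange_single_of_ne hjk]; simp
        · left; rw [hγk]; push_cast; omega
    · have hγk : γ.1 k = 0 := by rw [hi]; simp [Ne.symm hik, hjk.symm]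
      have : signChange k γ.1 = γ.1 := by
        rw [hi, signChange_add, signChange_single_of_ne hik, signChange_single_of_ne hjk]
      rw [hγk, this, add_zero]
      exact hγ.2

theorem IsPosGradient.not_neg {n : ℕ} {α : Fin n → ℤ} (h : IsPosGradient α) :
    ¬ IsPosGradient (-α) := by
  -- The first non-zero coordinate of a positive gradient is positive.
  have key : ∀ α : Fin n → ℤ, IsPosGradient α → ∃ i, 0 < α i ∧ ∀ j < i, α j = 0 := by
    rintro α (⟨i, rfl⟩ | ⟨i, j, hij, s, rfl⟩)
    · exact ⟨i, by simp, fun j hj => by simp [hj.ne]⟩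
    · exact ⟨i, by simp [hij.ne], fun k hk => by simp [hk.ne, (hk.trans hij).ne]⟩
  intro h'
  obtain ⟨i, hi, hi'⟩ := key _ h
  obtain ⟨j, hj, hj'⟩ := key _ h'
  simp only [Pi.neg_apply, neg_eq_zero] at hj hj'
  rcases lt_trichotomy i j with e | rfl | e
  · have := hj' i e; omega
  · omega
  · have := hi' j e; omega

theorem neg_notMem_posRoots {n : ℕ} {β : AffLat n} (h : β ∈ posRoots n) : -β ∉ posRoots n := by
  rintro ⟨-, h'⟩
  have h2 := h.2
  simp only [Prod.snd_neg, Prod.fst_neg] at h'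
  rcases h2 with h2 | h2 <;> rcases h' with h' | h'
  · omega
  · omega
  · omega
  · exact h2.2.not_neg h'.2

theorem simpleRoot_mem {n : ℕ} (hn : 0 < n) (i : Fin (n + 1)) :
    simpleRoot (n := n) i ∈ posRoots n := by
  rcases simpleRoot_cases hn i with h | h | ⟨a, b, hab, h⟩ <;> rw [h]
  · exact ⟨.inl ⟨⟨0, hn⟩, .inr (by simp [← Pi.single_neg])⟩, .inl (by simp)⟩
  · exact ⟨.inl ⟨⟨n - 1, by omega⟩, .inl (by simp)⟩, .inr ⟨rfl, .inl ⟨⟨n - 1, by omega⟩, by simp⟩⟩⟩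
  · have hab' : a < b := by rw [Fin.lt_def]; omega
    have e : (Pi.single a 1 - Pi.single b 1 : Fin n → ℤ) =
        Pi.single a 1 + Pi.single b ((-1 : ℤˣ) : ℤ) := by
      simp [sub_eq_add_neg, ← Pi.single_neg]
    refine ⟨.inr ⟨a, b, hab', 1, -1, ?_⟩, .inr ⟨rfl, .inr ⟨a, b, hab', -1, e⟩⟩⟩
    simpa using e

/-- The source of the symmetry of T_i: without the factor of a_i, the weight function is
s_i-invariant. The image is not a_i, since s_i a_i = -a_i is not positive. -/
theorem refl_simpleRoot_mem {n : ℕ} (hn : 0 < n) (i : Fin (n + 1)) {γ : AffLat n}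
    (hγ : γ ∈ posRoots n \ {simpleRoot i}) :
    refl (simpleRoot i) γ ∈ posRoots n \ {simpleRoot i} := by
  obtain ⟨hγ, hne⟩ := hγ
  have hr := isReflRoot_simpleRoot hn i
  refine ⟨?_, fun e => ?_⟩
  · rcases simpleRoot_cases hn i with h | h | ⟨a, b, hab, h⟩
    · exact refl_zero_mem (fun i => Fin.le_def.2 (Nat.zero_le _)) h hγ hne
    · exact refl_last_mem (fun i => Fin.le_def.2 (by simp; omega)) h hγ hne
    · exact refl_swap_mem hab h hγ hne
  · have h1 := congrArg (refl (simpleRoot i)) (Set.mem_singleton_iff.1 e)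
    rw [hr.refl_refl, hr.refl_self] at h1
    exact neg_notMem_posRoots (simpleRoot_mem hn i) (h1 ▸ hγ)

/-! ### Values of roots and of the functions `v_β` -/

/-- The value of `x^β`. -/
noncomputable def rootVal {n : ℕ} (p : Params) (β : AffLat n) (x : Fin n → ℂ) : ℂ :=
  (p.q : ℂ) ^ β.2 * monoVal x β.1

/-- The value of `x^{β/2}` for a long root `β`. -/
noncomputable def halfVal {n : ℕ} (p : Params) (β : AffLat n) (x : Fin n → ℂ) : ℂ :=
  (p.qh : ℂ) ^ β.2 * monoVal x fun k => β.1 k / 2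

theorem halfVal_mul_self {n : ℕ} (p : Params) {β : AffLat n} (hβ : IsLong β.1) {x : Fin n → ℂ}
    (hx : ∀ k, x k ≠ 0) : halfVal p β x * halfVal p β x = rootVal p β x := by
  rw [halfVal, rootVal, ← half_add_half hβ, monoVal_add hx, half_add_half hβ, Params.q,
    Units.val_pow_eq_pow_val, pow_two, mul_zpow]
  ring

theorem eval_one_sub_mono {n : ℕ} (p : Params) (β : AffLat n) {x : Fin n → ℂ}
    (hx : ∀ k, x k ≠ 0) : eval x (1 - mono p β) = 1 - rootVal p β x := by
  rw [← evalHom_apply hx, map_sub, map_one, evalHom_apply, eval_mono, rootVal]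

theorem eval_vNum_long {n : ℕ} (p : Params) {β : AffLat n} (hβ : IsLong β.1) {x : Fin n → ℂ}
    (hx : ∀ k, x k ≠ 0) : eval x (vNum p β) =
      (1 - p.mult β * p.multHalf β * halfVal p β x) *
        (1 + p.mult β * (p.multHalf β : ℂ)⁻¹ * halfVal p β x) := by
  rw [← evalHom_apply hx, vNum, if_pos hβ, map_mul, map_sub, map_add, map_one, evalHom_apply,
    evalHom_apply, eval_single, eval_single, halfVal]
  simp only [Units.val_mul, Units.val_inv_eq_inv_val, Units.val_zpow_eq_zpow_val, mul_assoc]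

theorem eval_vNum_medium {n : ℕ} (p : Params) {β : AffLat n} (hβ : ¬ IsLong β.1) {x : Fin n → ℂ}
    (hx : ∀ k, x k ≠ 0) : eval x (vNum p β) = 1 - (p.mult β : ℂ) ^ 2 * rootVal p β x := by
  rw [← evalHom_apply hx, vNum, if_neg hβ, map_sub, map_smul, map_one, evalHom_apply, eval_mono,
    rootVal, smul_eq_mul, Units.val_pow_eq_pow_val]

/-! ### The action of the simple reflections on points -/

/-- `Φ` is the action of `s_β` on points with non-zero coordinates. -/
structure IsPointRefl {n : ℕ} (p : Params) (β : AffLat n) (Φ : (Fin n → ℂ) → Fin n → ℂ) :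
    Prop where
  ne_zero : ∀ x, (∀ k, x k ≠ 0) → ∀ k, Φ x k ≠ 0
  rootVal : ∀ x, (∀ k, x k ≠ 0) → ∀ γ : AffLat n,
    rootVal p γ (Φ x) = rootVal p (refl β γ) x
  halfVal : ∀ x, (∀ k, x k ≠ 0) → ∀ γ : AffLat n, IsLong γ.1 →
    halfVal p γ (Φ x) = halfVal p (refl β γ) x
  long : ∀ γ : AffLat n, IsLong (refl β γ).1 ↔ IsLong γ.1
  parity : ∀ γ : AffLat n, IsLong γ.1 → (Even (refl β γ).2 ↔ Even γ.2)

/-- The multiplicities depend only on the length of the root and on the parity of the coefficient of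
δ for long roots. Reflections keep both, so only monomials have to be compared. -/
theorem IsPointRefl.v {n : ℕ} {p : Params} {β : AffLat n} {Φ : (Fin n → ℂ) → Fin n → ℂ}
    (h : IsPointRefl p β Φ) {x : Fin n → ℂ} (hx : ∀ k, x k ≠ 0) (γ : AffLat n) :
    v p γ (Φ x) = v p (refl β γ) x := by
  have hΦ := h.ne_zero x hx
  rw [Koornwinder.v, Koornwinder.v, eval_one_sub_mono p γ hΦ, eval_one_sub_mono p _ hx,
    h.rootVal x hx]
  congr 1
  by_cases hl : IsLong γ.1
  · have hl' := (h.long γ).2 hl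
    have e1 : p.mult (refl β γ) = p.mult γ := by
      simp only [Params.mult, hl, hl', h.parity γ hl]
    have e2 : p.multHalf (refl β γ) = p.multHalf γ := by
      simp only [Params.multHalf, h.parity γ hl]
    rw [eval_vNum_long p hl hΦ, eval_vNum_long p hl' hx, h.halfVal x hx γ hl, e1, e2]
  · have hl' : ¬ IsLong (refl β γ).1 := fun e => hl ((h.long γ).1 e)
    have e1 : p.mult (refl β γ) = p.mult γ := by
      simp only [Params.mult, hl, hl', if_false]
    rw [eval_vNum_medium p hl hΦ, eval_vNum_medium p hl' hx, h.rootVal x hx, e1]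

theorem IsPointRefl.eval {n : ℕ} {p : Params} {β : AffLat n} {Φ : (Fin n → ℂ) → Fin n → ℂ}
    (h : IsPointRefl p β Φ) {x : Fin n → ℂ} (hx : ∀ k, x k ≠ 0) (f : Laurent n) :
    eval (Φ x) f = eval x (reflAct p β f) := by
  have hΦ := h.ne_zero x hx
  rw [← evalHom_apply hΦ, ← evalHom_apply hx]
  induction f using AddMonoidAlgebra.induction_linear with
  | zero => simp
  | add f g hf hg => rw [map_add, map_add, map_add, hf, hg]
  | single μ z =>
    have h1 := h.rootVal x hx (μ, 0)
    rw [evalHom_apply, eval_single, reflAct_single, map_smul, evalHom_apply, eval_mono]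
    simp only [Koornwinder.rootVal, zpow_zero, one_mul] at h1
    rw [h1, smul_eq_mul]

theorem monoVal_comp_swap {n : ℕ} (x : Fin n → ℂ) (a b : Fin n) (μ : Fin n → ℤ) :
    monoVal (x ∘ Equiv.swap a b) μ = monoVal x (μ ∘ Equiv.swap a b) := by
  rw [monoVal, monoVal, ← Equiv.prod_comp (Equiv.swap a b)]
  simp

theorem isPointRefl_swap {n : ℕ} (p : Params) {a b : Fin n} (hab : a ≠ b) :
    IsPointRefl p (Pi.single a 1 - Pi.single b 1, 0) fun x => x ∘ Equiv.swap a b where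
  ne_zero x hx k := hx _
  rootVal x hx γ := by
    rw [refl_medium a b hab, rootVal, rootVal, monoVal_comp_swap]
  halfVal x hx γ hγ := by
    rw [refl_medium a b hab, halfVal, halfVal, monoVal_comp_swap]
    rfl
  long γ := by rw [refl_medium a b hab]; exact isLong_comp_swap a b
  parity γ hγ := by rw [refl_medium a b hab]

theorem monoVal_update_div {n : ℕ} (x : Fin n → ℂ) (k : Fin n) (w : ℂ) (μ : Fin n → ℤ) :
    monoVal (Function.update x k (w / x k)) μ = w ^ μ k * monoVal x (signChange k μ) := by
  have h : ∀ l, (Function.update x k (w / x k)) l ^ μ l =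
      (if l = k then w ^ μ l else 1) * x l ^ signChange k μ l := by
    intro l
    by_cases hl : l = k
    · subst hl; simp [signChange, div_eq_mul_inv, mul_zpow]
    · simp [signChange, hl]
  rw [monoVal, Finset.prod_congr rfl fun l _ => h l, Finset.prod_mul_distrib,
    Finset.prod_ite_eq' Finset.univ k]
  simp [monoVal]

/-- For a_n this is x_n ↦ 1 / x_n, and for a_0 it is x_1 ↦ q / x_1. The parity is kept because the
coordinates of long roots are even. -/
theorem isPointRefl_signChange {n : ℕ} (p : Params) (k : Fin n) (z : ℤˣ) (m : ℤ) :
    IsPointRefl p (Pi.single k (2 * (z : ℤ)), m)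
      fun x => Function.update x k ((p.q : ℂ) ^ (-m * z) / x k) where
  ne_zero x hx l := by
    by_cases hl : l = k
    · subst hl; simpa using ⟨zpow_ne_zero _ (Units.ne_zero _), hx _⟩
    · simpa [hl] using hx l
  rootVal x hx γ := by
    rw [refl_long, rootVal, rootVal, monoVal_update_div, ← mul_assoc, ← zpow_mul,
      ← zpow_add₀ (Units.ne_zero _)]
    congr 2
    ring
  halfVal x hx γ hγ := by
    obtain ⟨c, hc⟩ := hγ.even_apply k
    have h1 : (fun l => signChange k γ.1 l / 2) = signChange k fun l => γ.1 l / 2 := by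
      ext l
      by_cases hl : l = k
      · subst hl; simp only [signChange, Function.update_self, hc]; omega
      · simp [signChange, hl]
    have h2 : γ.1 k / 2 = c := by omega
    rw [refl_long, halfVal, halfVal, monoVal_update_div, ← mul_assoc, Params.q, h2,
      Units.val_pow_eq_pow_val, ← zpow_natCast, ← zpow_mul, ← zpow_mul,
      ← zpow_add₀ (Units.ne_zero _)]
    congr 2
    · rw [hc]; push_cast; ring
    · exact h1.symm
  long γ := by rw [refl_long]; exact isLong_signChange k
  parity γ hγ := by
    obtain ⟨c, hc⟩ := hγ.even_apply k
    rw [refl_long, hc, Int.even_sub]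
    have : Even (m * z * (c + c)) := ⟨m * z * c, by ring⟩
    simp [this]

/-! ### The denominators of `1 / v_β` -/

/-- The bounds on the parameters: `q`, `t²`, `a`, `b`, `c`, `d` lie in the unit disc. -/
structure Params.IsSmall (p : Params) (s : ℝ) : Prop where
  lt_one : s < 1
  qh : ‖(p.qh : ℂ)‖ < 1
  t : ‖(p.t : ℂ) ^ 2‖ ≤ s
  a : ‖p.a‖ ≤ s
  b : ‖p.b‖ ≤ s
  c : ‖p.c‖ ≤ s
  d : ‖p.d‖ ≤ s

theorem posRoots_nonneg {n : ℕ} {γ : AffLat n} (hγ : γ ∈ posRoots n) : 0 ≤ γ.2 := by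
  rcases hγ.2 with h | h <;> omega

theorem pos_of_apply_neg {n : ℕ} {k : Fin n} (hk : ∀ i, k ≤ i) {γ : AffLat n}
    (hγ : γ ∈ posRoots n) (h : γ.1 k < 0) : 0 < γ.2 := by
  rcases hγ.2 with h' | ⟨-, ⟨i, hi⟩ | ⟨i, j, hij, s, hi⟩⟩
  · exact h'
  · rw [hi] at h
    by_cases e : k = i <;> simp [e] at h
  · have e' : k ≠ j := fun e => absurd hij (by rw [← e]; exact not_lt.2 (hk i))
    rw [hi] at h
    by_cases e : k = i <;> simp [e, e', hij.ne] at h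

/-- For a positive root `γ`, the numerator of `v_γ` is `(1 - A w) (1 - B w)`, where `A` and `B` are
small and `w` is a monomial in `q^{1/2}` and `x`. -/
theorem exists_factor {n : ℕ} {p : Params} {s : ℝ} (h : p.IsSmall s) {k : Fin n}
    (hk : ∀ i, k ≤ i) {γ : AffLat n} (hγ : γ ∈ posRoots n) {x : Fin n → ℂ}
    (hx : ∀ k, x k ≠ 0) :
    ∃ (A B w : ℂ) (e : ℤ) (μ : Fin n → ℤ), ‖A‖ ≤ s ∧ ‖B‖ ≤ s ∧
      eval x (vNum p γ) = (1 - A * w) * (1 - B * w) ∧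
      ‖w‖ = ‖(p.qh : ℂ)‖ ^ e * ‖monoVal x μ‖ ∧ 0 ≤ e ∧ γ.2 - 1 ≤ e ∧ -1 ≤ μ k ∧
      (μ k < 0 → 1 ≤ e ∨ γ = (Pi.single k (2 * ((-1 : ℤˣ) : ℤ)), 1)) ∧
      (‖w‖ ≤ 1 → ‖rootVal p γ x‖ ≤ ‖w‖) := by
  have hm := posRoots_nonneg hγ
  have hqh : (p.qh : ℂ) ≠ 0 := Units.ne_zero _
  have hs : 0 ≤ s := (norm_nonneg _).trans h.a
  by_cases hl : IsLong γ.1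
  · have hH := halfVal_mul_self p hl hx
    have hηk : -1 ≤ γ.1 k / 2 := by
      obtain ⟨i, r, hi⟩ := isLong_iff.1 hl
      rw [hi]
      by_cases e : k = i
      · rcases Int.units_eq_one_or r with rfl | rfl <;> simp [e]
      · simp [e]
    rw [eval_vNum_long p hl hx]
    by_cases hev : Even γ.2
    · refine ⟨p.c, p.d, halfVal p γ x, γ.2, fun k => γ.1 k / 2, h.c, h.d, ?_, ?_, hm, by omega,
        hηk, fun h1 => ?_, fun h1 => ?_⟩
      · simp only [Params.mult, hl, hev, Params.multHalf, Params.c, Params.d, if_true]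
        ring
      · rw [halfVal, norm_mul, norm_zpow]
      · left
        have := pos_of_apply_neg hk hγ (by dsimp only at h1; omega)
        omega
      · rw [← hH, norm_mul]
        exact mul_le_of_le_one_left (norm_nonneg _) h1
    · have hpos : 1 ≤ γ.2 := by
        rcases hm.eq_or_lt with e | e
        · rw [← e] at hev; simp at hev
        · omega
      have hH' : halfVal p γ x = p.qh * (halfVal p γ x / p.qh) := by field_simp
      -- Odd m: one factor q^{1/2} moves from x^{γ/2} into a and b, which leaves the exponent m - 1.
      -- Hence a_0 gives w = x_1⁻¹ with e = 0, the exceptional case of the statement.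
      refine ⟨p.a, p.b, halfVal p γ x / p.qh, γ.2 - 1, fun k => γ.1 k / 2, h.a, h.b, ?_, ?_,
        by omega, by omega, hηk, fun h1 => ?_, fun h1 => ?_⟩
      · simp only [Params.mult, hl, hev, Params.multHalf, Params.a, Params.b, if_true, if_false]
        field_simp
        ring
      · rw [halfVal, norm_div, norm_mul, norm_zpow, zpow_sub_one₀ (norm_ne_zero_iff.2 hqh)]
        ring
      · rcases (show γ.2 = 1 ∨ 1 ≤ γ.2 - 1 by omega) with h2 | h2
        · right
          obtain ⟨i, r, hi⟩ := isLong_iff.1 hl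
          simp only [hi] at h1
          by_cases e : k = i
          · subst e
            rcases Int.units_eq_one_or r with rfl | rfl
            · simp at h1
            · exact Prod.ext (by rw [hi]; simp) h2
          · simp [e] at h1
        · exact .inl h2
      · rw [← hH]
        nth_rw 1 2 [hH']
        rw [norm_mul, norm_mul]
        have h3 := h.qh.le
        have h0 := norm_nonneg (p.qh : ℂ)
        have h4 : ‖(p.qh : ℂ)‖ * ‖halfVal p γ x / p.qh‖ ≤ 1 := mul_le_one₀ h3 (norm_nonneg _) h1
        calc _ ≤ 1 * (‖(p.qh : ℂ)‖ * ‖halfVal p γ x / p.qh‖) := by gcongr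
          _ ≤ 1 * (1 * ‖halfVal p γ x / p.qh‖) := by gcongr
          _ = _ := by ring
  · have hmed := hγ.1.resolve_left hl
    -- Medium roots have a single factor, so B = 0. The exponent is 2 m because q = (q^{1/2})².
    refine ⟨(p.t : ℂ) ^ 2, 0, rootVal p γ x, 2 * γ.2, γ.1, h.t, by simpa using hs, ?_, ?_,
      by omega, by omega, ?_, fun h1 => ?_, fun _ => le_rfl⟩
    · rw [eval_vNum_medium p hl hx]
      simp [Params.mult, hl]
    · rw [rootVal, norm_mul, norm_zpow, Params.q, Units.val_pow_eq_pow_val, norm_pow,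
        ← zpow_natCast, ← zpow_mul]
      rfl
    · obtain ⟨i, j, hij, r, s, hi⟩ := hmed
      have e' : k ≠ j := fun e => absurd hij (by rw [← e]; exact not_lt.2 (hk i))
      rw [hi]
      by_cases e : k = i
      · rcases Int.units_eq_one_or r with rfl | rfl <;> simp [e, hij.ne]
      · simp [e, e']
    · left
      have := pos_of_apply_neg hk hγ h1
      omega

/-! ### Non-vanishing of the numerators and the estimate of 1 / v_β -/

theorem one_sub_mul_ne_zero {A w : ℂ} {s : ℝ} (hs : s < 1) (hA : ‖A‖ ≤ s) (hw : ‖w‖ ≤ 1) :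
    1 - A * w ≠ 0 := by
  intro h0
  have h1 : ‖A * w‖ < 1 := by
    rw [norm_mul]
    calc ‖A‖ * ‖w‖ ≤ ‖A‖ * 1 := by gcongr
      _ < 1 := by linarith
  rw [← sub_eq_zero.1 h0] at h1
  simp at h1

theorem norm_monoVal_of_norm_eq_one {n : ℕ} {k : Fin n} {x : Fin n → ℂ}
    (hx : ∀ l, l ≠ k → ‖x l‖ = 1) (μ : Fin n → ℤ) : ‖monoVal x μ‖ = ‖x k‖ ^ μ k := by
  rw [monoVal, norm_prod, Finset.prod_eq_single k]
  · exact norm_zpow _ _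
  · intro l _ hl
    rw [norm_zpow, hx l hl, one_zpow]
  · simp

/-- The numerators of the functions `v_γ`, `γ ≠ a_0`, have no zeros on the annulus
`|q^{1/2}| ≤ |x_1| ≤ 1`, `|x_2| = ⋯ = |x_n| = 1`. -/
theorem eval_vNum_ne_zero_of_annulus {n : ℕ} {p : Params} {s : ℝ} (h : p.IsSmall s) {k : Fin n}
    (hk : ∀ i, k ≤ i) {γ : AffLat n} (hγ : γ ∈ posRoots n) {x : Fin n → ℂ}
    (hx : ∀ l, l ≠ k → ‖x l‖ = 1) (hx1 : ‖(p.qh : ℂ)‖ ≤ ‖x k‖) (hx2 : ‖x k‖ ≤ 1)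
    (hne : γ ≠ (Pi.single k (2 * ((-1 : ℤˣ) : ℤ)), 1)) : eval x (vNum p γ) ≠ 0 := by
  have hqh : 0 < ‖(p.qh : ℂ)‖ := norm_pos_iff.2 (Units.ne_zero _)
  have hx0 : ∀ l, x l ≠ 0 := fun l => by
    by_cases e : l = k
    · subst e; exact norm_pos_iff.1 (hqh.trans_le hx1)
    · exact norm_ne_zero_iff.1 (by rw [hx l e]; exact one_ne_zero)
  obtain ⟨A, B, w, e, μ, hA, hB, hv, hw, he0, -, hμ, hμ', -⟩ := exists_factor h hk hγ hx0
  have hw1 : ‖w‖ ≤ 1 := by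
    rw [hw, norm_monoVal_of_norm_eq_one hx]
    rcases lt_or_ge (μ k) 0 with h1 | h1
    · have h2 := (hμ' h1).resolve_right hne
      have h3 : μ k = -1 := by omega
      have h4 : ‖(p.qh : ℂ)‖ ^ e ≤ ‖(p.qh : ℂ)‖ ^ (1 : ℤ) :=
        zpow_le_zpow_right_of_le_one₀ hqh h.qh.le h2
      rw [h3, zpow_neg_one, ← div_eq_mul_inv, div_le_one (hqh.trans_le hx1)]
      rw [zpow_one] at h4
      exact h4.trans hx1
    · exact mul_le_one₀ (zpow_le_one₀ hqh h.qh.le he0) (by positivity)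
        (zpow_le_one₀ (hqh.trans_le hx1) hx2 h1)
  rw [hv]
  exact mul_ne_zero (one_sub_mul_ne_zero h.lt_one hA hw1) (one_sub_mul_ne_zero h.lt_one hB hw1)

theorem eval_vNum_ne_zero {n : ℕ} {p : Params} {s : ℝ} (h : p.IsSmall s) {k : Fin n}
    (hk : ∀ i, k ≤ i) {γ : AffLat n} (hγ : γ ∈ posRoots n) {x : Fin n → ℂ}
    (hx : ∀ l, ‖x l‖ = 1) : eval x (vNum p γ) ≠ 0 := by
  have hx0 : ∀ l, x l ≠ 0 := fun l => norm_ne_zero_iff.1 (by rw [hx l]; exact one_ne_zero)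
  obtain ⟨A, B, w, e, μ, hA, hB, hv, hw, he0, -⟩ := exists_factor h hk hγ hx0
  have hw1 : ‖w‖ ≤ 1 := by
    rw [hw, norm_monoVal hx, mul_one]
    exact zpow_le_one₀ (norm_pos_iff.2 (Units.ne_zero _)) h.qh.le he0
  rw [hv]
  exact mul_ne_zero (one_sub_mul_ne_zero h.lt_one hA hw1) (one_sub_mul_ne_zero h.lt_one hB hw1)

theorem v_inv {n : ℕ} (p : Params) (γ : AffLat n) {x : Fin n → ℂ} (hx : ∀ k, x k ≠ 0) :
    (v p γ x)⁻¹ = (1 - rootVal p γ x) / eval x (vNum p γ) := by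
  rw [v, inv_div, eval_one_sub_mono p γ hx]

/-- Over the common denominator the numerator has the four terms A w, B w, A B w² and K, each of
norm at most |w|. The denominator has norm at least (1 - s)². -/
theorem norm_div_sub_one_le {A B w K : ℂ} {s : ℝ} (hs : s < 1) (hA : ‖A‖ ≤ s) (hB : ‖B‖ ≤ s)
    (hw : ‖w‖ ≤ 1) (hK : ‖K‖ ≤ ‖w‖) :
    ‖(1 - K) / ((1 - A * w) * (1 - B * w)) - 1‖ ≤ 4 / (1 - s) ^ 2 * ‖w‖ := by
  have key : ∀ C : ℂ, ‖C‖ ≤ s → 1 - s ≤ ‖1 - C * w‖ := fun C hC => by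
    have h1 : ‖C * w‖ ≤ s := by
      rw [norm_mul]
      calc ‖C‖ * ‖w‖ ≤ ‖C‖ * 1 := by gcongr
        _ ≤ s := by linarith
    have h2 := norm_sub_norm_le (1 : ℂ) (C * w)
    rw [norm_one] at h2
    linarith
  have hA0 := one_sub_mul_ne_zero hs hA hw
  have hB0 := one_sub_mul_ne_zero hs hB hw
  have e : (1 - K) / ((1 - A * w) * (1 - B * w)) - 1 =
      ((A + B) * w - A * B * w * w - K) / ((1 - A * w) * (1 - B * w)) := by
    rw [eq_div_iff (mul_ne_zero hA0 hB0), sub_mul, div_mul_cancel₀ _ (mul_ne_zero hA0 hB0)]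
    ring
  have hs0 : 0 < 1 - s := by linarith
  have hw0 := norm_nonneg w
  have hA1 : ‖A‖ ≤ 1 := hA.trans hs.le
  have hB1 : ‖B‖ ≤ 1 := hB.trans hs.le
  rw [e, norm_div, norm_mul, div_mul_eq_mul_div]
  have h1 : ‖(A + B) * w - A * B * w * w - K‖ ≤ 4 * ‖w‖ := by
    calc _ ≤ ‖(A + B) * w‖ + ‖A * B * w * w‖ + ‖K‖ :=
          (norm_sub_le _ _).trans (by gcongr; exact norm_sub_le _ _)
      _ ≤ (‖A‖ + ‖B‖) * ‖w‖ + ‖A‖ * ‖B‖ * ‖w‖ * ‖w‖ + ‖w‖ := by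
          simp only [norm_mul]; gcongr; exact norm_add_le _ _
      _ ≤ (1 + 1) * ‖w‖ + 1 * 1 * 1 * ‖w‖ + ‖w‖ := by gcongr
      _ = 4 * ‖w‖ := by ring
  have h2 : (1 - s) ^ 2 ≤ ‖1 - A * w‖ * ‖1 - B * w‖ := by
    rw [pow_two]; exact mul_le_mul (key A hA) (key B hB) hs0.le (norm_nonneg _)
  gcongr

/-- `1 / v_γ = 1 + O(|q^{1/2}|^m)` on the torus, for `γ = α + m δ`. -/
theorem norm_v_inv_sub_one_le {n : ℕ} {p : Params} {s : ℝ} (h : p.IsSmall s) {k : Fin n}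
    (hk : ∀ i, k ≤ i) {γ : AffLat n} (hγ : γ ∈ posRoots n) {x : Fin n → ℂ}
    (hx : ∀ l, ‖x l‖ = 1) :
    ‖(v p γ x)⁻¹ - 1‖ ≤ 4 / (1 - s) ^ 2 * ‖(p.qh : ℂ)‖ ^ (γ.2 - 1) := by
  have hx0 : ∀ l, x l ≠ 0 := fun l => norm_ne_zero_iff.1 (by rw [hx l]; exact one_ne_zero)
  obtain ⟨A, B, w, e, μ, hA, hB, hv, hw, he0, he1, -, -, hK⟩ := exists_factor h hk hγ hx0
  have hqh : 0 < ‖(p.qh : ℂ)‖ := norm_pos_iff.2 (Units.ne_zero _)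
  rw [norm_monoVal hx, mul_one] at hw
  have hw1 : ‖w‖ ≤ 1 := hw ▸ zpow_le_one₀ hqh h.qh.le he0
  rw [v_inv p γ hx0, hv]
  refine (norm_div_sub_one_le h.lt_one hA hB hw1 (hK hw1)).trans ?_
  rw [hw]
  have hs0 : 0 < 1 - s := by linarith [h.lt_one]
  gcongr ?_ * ?_
  exact zpow_le_zpow_right_of_le_one₀ hqh h.qh.le he1

open MeasureTheory Filter Topology

/-! ### Integrals over circles and tori -/

theorem circleIntegral_inv_smul (F : ℂ → ℂ) {R : ℝ} (hR : R ≠ 0) :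
    (∮ z in C(0, R), (z - 0)⁻¹ • F z) =
      Complex.I * ∫ θ in (0 : ℝ)..2 * Real.pi, F (circleMap 0 R θ) := by
  rw [circleIntegral, ← intervalIntegral.integral_const_mul]
  congr 1
  ext θ
  have h : circleMap 0 R θ ≠ 0 := circleMap_ne_center hR
  simp only [deriv_circleMap, sub_zero, smul_eq_mul]
  field_simp

/-- If `F` is holomorphic on the annulus `r ≤ |z| ≤ 1` and changes its sign under `z ↦ r² / z`,
then its mean value over the unit circle is zero. -/
theorem integral_circle_eq_zero {F : ℂ → ℂ} {r : ℝ} (h0 : 0 < r) (h1 : r ≤ 1)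
    (hd : ∀ z, r ≤ ‖z‖ → ‖z‖ ≤ 1 → DifferentiableAt ℂ F z)
    (ha : ∀ z, ‖z‖ = r → F ((r : ℂ) ^ 2 / z) = -F z) :
    ∫ θ in (0 : ℝ)..2 * Real.pi, F (circleMap 0 1 θ) = 0 := by
  -- By Cauchy's theorem the mean values over the circles of radius 1 and r agree.
  have e1 := Complex.circleIntegral_sub_center_inv_smul_eq_of_differentiable_on_annulus_off_countable
    (c := 0) (f := F) h0 h1 Set.countable_empty
    (fun z hz => by
      simp only [Set.mem_sdiff, Metric.mem_closedBall, Metric.mem_ball, dist_zero_right, not_lt] at hz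
      exact (hd z hz.2 hz.1).continuousAt.continuousWithinAt)
    (fun z hz => by
      simp only [Set.sdiff_empty, Set.mem_sdiff, Metric.mem_closedBall, Metric.mem_ball,
        dist_zero_right, not_le] at hz
      exact hd z hz.2.le hz.1.le)
  rw [circleIntegral_inv_smul F one_ne_zero, circleIntegral_inv_smul F h0.ne'] at e1
  rw [mul_left_cancel₀ Complex.I_ne_zero e1]
  -- On the circle of radius r the map z ↦ r² / z is θ ↦ 2π - θ, so the mean value equals its own
  -- negative.
  have e2 : ∀ θ : ℝ, F (circleMap 0 r (2 * Real.pi - θ)) = -F (circleMap 0 r θ) := fun θ => by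
    rw [← ha _ (by simp [abs_of_pos h0])]
    congr 1
    have : (r : ℂ) ≠ 0 := by exact_mod_cast h0.ne'
    simp only [circleMap, zero_add, Complex.ofReal_sub, sub_mul, Complex.exp_sub]
    push_cast
    rw [Complex.exp_two_pi_mul_I]
    field_simp
  have e3 := intervalIntegral.integral_comp_sub_left (fun θ => F (circleMap 0 r θ)) (2 * Real.pi)
    (a := 0) (b := 2 * Real.pi)
  simp only [e2, sub_self, sub_zero, intervalIntegral.integral_neg] at e3
  exact self_eq_neg.1 e3.symm

/-- Fubini, with the k-th coordinate integrated first. -/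
theorem setIntegral_Icc_eq_zero_of_update {n : ℕ} (k : Fin n) {h : (Fin n → ℝ) → ℂ}
    (hc : Continuous h)
    (h0 : ∀ θ, ∫ s in (0 : ℝ)..2 * Real.pi, h (Function.update θ k s) = 0) :
    ∫ θ in Set.Icc 0 (fun _ => 2 * Real.pi), h θ = 0 := by
  obtain _ | n := n
  · exact k.elim0
  set e : ℝ × (Fin n → ℝ) ≃ᵐ (Fin (n + 1) → ℝ) :=
    (MeasurableEquiv.piFinSuccAbove (fun _ => ℝ) k).symm
  have hem : MeasurePreserving e :=
    (volume_preserving_piFinSuccAbove (fun _ : Fin (n + 1) => ℝ) k).symm _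
  have heπ : (e ⁻¹' Set.Icc 0 fun _ => 2 * Real.pi) =
      Set.Icc 0 (2 * Real.pi) ×ˢ Set.Icc (0 : Fin n → ℝ) fun _ => 2 * Real.pi :=
    ((Fin.insertNthOrderIso (fun _ => ℝ) k).preimage_Icc _ _).trans (Set.Icc_prod_eq _ _)
  have hi : IntegrableOn (fun a => h (e a))
      (Set.Icc 0 (2 * Real.pi) ×ˢ Set.Icc (0 : Fin n → ℝ) fun _ => 2 * Real.pi)
      (volume.prod volume) := by
    have h1 : IntegrableOn h (Set.Icc 0 fun _ => 2 * Real.pi) := hc.integrableOn_Icc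
    have h2 := (hem.integrableOn_comp_preimage e.measurableEmbedding).2 h1
    rwa [heπ, Measure.volume_eq_prod] at h2
  rw [IntegrableOn, ← Measure.prod_restrict] at hi
  rw [← hem.map_eq, setIntegral_map_equiv, heπ, Measure.volume_eq_prod, ← Measure.prod_restrict,
    integral_prod_symm _ hi]
  refine integral_eq_zero_of_ae (Filter.Eventually.of_forall fun y => ?_)
  have h2 := h0 (e (0, y))
  rw [intervalIntegral.integral_of_le Real.two_pi_pos.le, ← integral_Icc_eq_integral_Ioc] at h2
  rw [Pi.zero_apply, ← h2]
  refine setIntegral_congr_fun measurableSet_Icc fun s _ => congrArg h ?_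
  change Fin.insertNth k s y =
    Function.update (Fin.insertNth (α := fun _ => ℝ) k 0 y : Fin (n + 1) → ℝ) k s
  exact (Fin.update_insertNth _ _ _ _).symm

theorem setIntegral_Icc_comp_perm {n : ℕ} (σ : Equiv.Perm (Fin n)) (h : (Fin n → ℝ) → ℂ) :
    ∫ θ in Set.Icc 0 (fun _ => 2 * Real.pi), h (θ ∘ σ) =
      ∫ θ in Set.Icc 0 (fun _ => 2 * Real.pi), h θ := by
  have hem := (volume_measurePreserving_piCongrLeft (fun _ : Fin n => ℝ) σ).symm
  have he : ∀ θ : Fin n → ℝ, (MeasurableEquiv.piCongrLeft (fun _ : Fin n => ℝ) σ).symm θ = θ ∘ σ :=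
    fun θ => rfl
  have := hem.setIntegral_preimage_emb (MeasurableEquiv.measurableEmbedding _) h
    (Set.Icc 0 (fun _ => 2 * Real.pi))
  rw [← this]
  congr 1
  congr 1
  ext θ
  exact ⟨fun hθ => ⟨fun k => by simpa [he] using hθ.1 (σ k), fun k => by simpa [he] using hθ.2 (σ k)⟩,
    fun hθ => ⟨fun k => by simpa [he] using hθ.1 (σ.symm k),
      fun k => by simpa [he] using hθ.2 (σ.symm k)⟩⟩

/-! ### Regularity of Laurent polynomials along the torus -/

theorem torusMap_apply {n : ℕ} (θ : Fin n → ℝ) (k : Fin n) :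
    torusMap 0 1 θ k = circleMap 0 1 (θ k) := by
  simp [torusMap, circleMap]

theorem norm_torusMap {n : ℕ} (θ : Fin n → ℝ) (k : Fin n) :
    ‖torusMap (0 : Fin n → ℂ) 1 θ k‖ = 1 := by
  simp [torusMap_apply]

theorem torusMap_ne_zero {n : ℕ} (θ : Fin n → ℝ) (k : Fin n) :
    torusMap (0 : Fin n → ℂ) 1 θ k ≠ 0 :=
  norm_ne_zero_iff.1 (by rw [norm_torusMap]; exact one_ne_zero)

theorem continuous_eval_torusMap {n : ℕ} (f : Laurent n) :
    Continuous fun θ : Fin n → ℝ => eval (torusMap 0 1 θ) f := by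
  refine continuous_finsetSum _ fun μ _ => continuous_const.mul
    (continuous_finsetProd _ fun k _ => ?_)
  refine Continuous.zpow₀ ?_ _ fun θ => .inl (torusMap_ne_zero θ k)
  simp only [torusMap_apply]
  exact (continuous_circleMap 0 1).comp (continuous_apply k)

theorem differentiableAt_eval_update {n : ℕ} (x : Fin n → ℂ) (k : Fin n) (f : Laurent n) {z : ℂ}
    (hz : z ≠ 0) : DifferentiableAt ℂ (fun z => eval (Function.update x k z) f) z := by
  refine DifferentiableAt.fun_sum fun μ _ => (differentiableAt_const _).mul
    (DifferentiableAt.fun_finsetProd fun l _ => ?_)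
  by_cases hl : l = k
  · subst hl
    simp only [Function.update_self]
    exact differentiableAt_id.zpow (.inl hz)
  · simp [hl]

/-! ### Symmetry of the `T_i` for finite products -/

theorem continuous_v_inv_torusMap {n : ℕ} {p : Params} {s : ℝ} (h : p.IsSmall s) (hn : 0 < n)
    {γ : AffLat n} (hγ : γ ∈ posRoots n) :
    Continuous fun θ : Fin n → ℝ => (v p γ (torusMap 0 1 θ))⁻¹ := by
  simp only [v, inv_div]
  exact (continuous_eval_torusMap _).div (continuous_eval_torusMap _) fun θ =>
    eval_vNum_ne_zero (k := ⟨0, hn⟩) h (fun i => Fin.le_def.2 (Nat.zero_le _)) hγ (norm_torusMap θ)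

/-- `(f · s_β g - s_β f · g) ∏_{γ ∈ S} 1 / v_γ`, which is anti-symmetric under `s_β` if `S` is
stable under `s_β`. -/
noncomputable def skewTerm {n : ℕ} (p : Params) (β : AffLat n) (S : Finset (AffLat n))
    (f g : Laurent n) (x : Fin n → ℂ) : ℂ :=
  (∏ γ ∈ S, (v p γ x)⁻¹) *
    (eval x f * eval x (reflAct p β g) - eval x (reflAct p β f) * eval x g)

theorem skewTerm_comp {n : ℕ} {p : Params} {β : AffLat n} (hβ : IsReflRoot β)
    {Φ : (Fin n → ℂ) → Fin n → ℂ} (hΦ : IsPointRefl p β Φ) {S : Finset (AffLat n)}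
    (hS : ∀ γ ∈ S, refl β γ ∈ S) (f g : Laurent n) {x : Fin n → ℂ} (hx : ∀ k, x k ≠ 0) :
    skewTerm p β S f g (Φ x) = -skewTerm p β S f g x := by
  have h1 : ∏ γ ∈ S, (v p γ (Φ x))⁻¹ = ∏ γ ∈ S, (v p γ x)⁻¹ :=
    Finset.prod_nbij' (refl β) (refl β) hS hS (fun γ _ => hβ.refl_refl γ)
      (fun γ _ => hβ.refl_refl γ) fun γ _ => by rw [hΦ.v hx]
  simp only [skewTerm, h1, hΦ.eval hx, hβ.reflAct_reflAct]
  ring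

theorem continuous_skewTerm_torusMap {n : ℕ} {p : Params} {s : ℝ} (h : p.IsSmall s) (hn : 0 < n)
    (β : AffLat n) {S : Finset (AffLat n)} (hS : ∀ γ ∈ S, γ ∈ posRoots n) (f g : Laurent n) :
    Continuous fun θ : Fin n → ℝ => skewTerm p β S f g (torusMap 0 1 θ) :=
  (continuous_finsetProd _ fun γ hγ => continuous_v_inv_torusMap h hn (hS γ hγ)).mul
    (((continuous_eval_torusMap _).mul (continuous_eval_torusMap _)).sub
      ((continuous_eval_torusMap _).mul (continuous_eval_torusMap _)))

/-- Only x_k moves, so the other coordinates are frozen on the unit circle. The reflection is x_k ↦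
r² / x_k, which preserves |x_k| = r, and `hv` excludes poles between this circle and the unit
circle. -/
theorem integral_skewTerm_signChange {n : ℕ} {p : Params} {s : ℝ} (h : p.IsSmall s) (hn : 0 < n)
    (k : Fin n) (z : ℤˣ) (m : ℤ) {S : Finset (AffLat n)} (hS : ∀ γ ∈ S, γ ∈ posRoots n)
    (hS' : ∀ γ ∈ S, refl (Pi.single k (2 * (z : ℤ)), m) γ ∈ S) {r : ℝ} (hr0 : 0 < r) (hr1 : r ≤ 1)
    (hr : (p.q : ℂ) ^ (-m * z) = (r : ℂ) ^ 2)
    (hv : ∀ γ ∈ S, ∀ x : Fin n → ℂ, (∀ l, l ≠ k → ‖x l‖ = 1) → r ≤ ‖x k‖ → ‖x k‖ ≤ 1 →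
      eval x (vNum p γ) ≠ 0) (f g : Laurent n) :
    ∫ θ in Set.Icc 0 (fun _ => 2 * Real.pi),
      skewTerm p (Pi.single k (2 * (z : ℤ)), m) S f g (torusMap 0 1 θ) = 0 := by
  refine setIntegral_Icc_eq_zero_of_update k (continuous_skewTerm_torusMap h hn _ hS f g) fun θ => ?_
  have e1 : ∀ s : ℝ, torusMap (0 : Fin n → ℂ) 1 (Function.update θ k s) =
      Function.update (torusMap 0 1 θ) k (circleMap 0 1 s) := fun s => by
    ext l
    by_cases hl : l = k
    · subst hl; simp [torusMap_apply]
    · simp [torusMap_apply, hl]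
  simp only [e1]
  set x := torusMap (0 : Fin n → ℂ) 1 θ with hx
  refine integral_circle_eq_zero
    (F := fun w => skewTerm p (Pi.single k (2 * (z : ℤ)), m) S f g (Function.update x k w))
    hr0 hr1 (fun w hw hw' => ?_) fun w hw => ?_
  · have hw0 : w ≠ 0 := norm_pos_iff.1 (hr0.trans_le hw)
    have hD := fun f => differentiableAt_eval_update x k f hw0
    refine (DifferentiableAt.fun_finsetProd fun γ hγ => ?_).mul
      (((hD _).mul (hD _)).sub ((hD _).mul (hD _)))
    simp only [v, inv_div]
    refine (hD _).div (hD _) (hv γ hγ _ (fun l hl => ?_) ?_ ?_)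
    · simp only [ne_eq, hl, not_false_eq_true, Function.update_of_ne]
      exact norm_torusMap θ l
    · simpa using hw
    · simpa using hw'
  · have hw0 : w ≠ 0 := norm_pos_iff.1 (by rw [hw]; exact hr0)
    have h2 := skewTerm_comp (isReflRoot_long k z m) (isPointRefl_signChange p k z m) hS' f g
      (x := Function.update x k w) fun l => by
        by_cases hl : l = k
        · subst hl; simpa using hw0
        · simpa [hl] using torusMap_ne_zero θ l
    rw [hr] at h2
    simpa using h2

theorem integral_skewTerm_eq_zero {n : ℕ} {p : Params} {s : ℝ} (h : p.IsSmall s) (hn : 0 < n)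
    (hq : (p.q : ℂ) = (‖(p.qh : ℂ)‖ : ℂ) ^ 2) (i : Fin (n + 1)) {S : Finset (AffLat n)}
    (hS : ∀ γ ∈ S, γ ∈ posRoots n \ {simpleRoot i})
    (hS' : ∀ γ ∈ S, refl (simpleRoot i) γ ∈ S) (f g : Laurent n) :
    ∫ θ in Set.Icc 0 (fun _ => 2 * Real.pi),
      skewTerm p (simpleRoot i) S f g (torusMap 0 1 θ) = 0 := by
  have hfirst : ∀ i : Fin n, (⟨0, hn⟩ : Fin n) ≤ i := fun i => Fin.le_def.2 (Nat.zero_le _)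
  rcases simpleRoot_cases hn i with e | e | ⟨a, b, hab, e⟩ <;> rw [e] at hS hS' ⊢
  · refine integral_skewTerm_signChange h hn _ _ _ (fun γ hγ => (hS γ hγ).1) hS'
      (norm_pos_iff.2 (Units.ne_zero _)) h.qh.le (by simpa using hq) (fun γ hγ x hx h1 h2 => ?_) f g
    exact eval_vNum_ne_zero_of_annulus h hfirst (hS γ hγ).1 hx h1 h2 (hS γ hγ).2
  · refine integral_skewTerm_signChange h hn _ _ _ (fun γ hγ => (hS γ hγ).1) hS'
      one_pos le_rfl (by simp) (fun γ hγ x hx h1 h2 => ?_) f g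
    refine eval_vNum_ne_zero h hfirst (hS γ hγ).1 fun l => ?_
    by_cases hl : l = ⟨n - 1, by omega⟩
    · subst hl; exact le_antisymm h2 h1
    · exact hx l hl
  · have hne : a ≠ b := fun e => by rw [e] at hab; omega
    have e1 := setIntegral_Icc_comp_perm (Equiv.swap a b) fun θ =>
      skewTerm p (Pi.single a 1 - Pi.single b 1, 0) S f g (torusMap 0 1 θ)
    have e2 : ∀ θ : Fin n → ℝ, skewTerm p (Pi.single a 1 - Pi.single b 1, 0) S f g
        (torusMap 0 1 (θ ∘ Equiv.swap a b)) =
        -skewTerm p (Pi.single a 1 - Pi.single b 1, 0) S f g (torusMap 0 1 θ) := fun θ => by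
      have e3 : torusMap (0 : Fin n → ℂ) 1 (θ ∘ Equiv.swap a b) =
          torusMap 0 1 θ ∘ Equiv.swap a b := by
        ext k; simp [torusMap_apply]
      rw [e3]
      exact skewTerm_comp (isReflRoot_medium hne) (isPointRefl_swap p hne) hS' f g
        (x := torusMap 0 1 θ) (torusMap_ne_zero θ)
    simp only [e2, integral_neg] at e1
    exact self_eq_neg.1 e1.symm

/-! ### Convergence of the weight function -/

/-- The gradients lie in the finite box [-2, 2]ⁿ, so the sum is dominated by finitely many geometric
series in m. -/
theorem summable_posRoots (n : ℕ) {r : ℝ} (h0 : 0 ≤ r) (h1 : r < 1) :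
    Summable fun γ : posRoots n => r ^ γ.1.2.toNat := by
  have hmem : ∀ γ : posRoots n, γ.1.1 ∈ Finset.Icc (fun _ => -2 : Fin n → ℤ) (fun _ => 2) := by
    intro γ
    rw [Finset.mem_Icc, Pi.le_def, Pi.le_def, ← forall_and]
    intro k
    rcases γ.2.1 with h | ⟨i, j, hij, r, s, h⟩
    · obtain ⟨i, r, h⟩ := isLong_iff.1 h
      rw [h]
      by_cases e : k = i <;> rcases Int.units_eq_one_or r with rfl | rfl <;> simp [e]
    · rw [h]
      by_cases e : k = i <;> by_cases e' : k = j <;> rcases Int.units_eq_one_or r with rfl | rfl <;>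
        rcases Int.units_eq_one_or s with rfl | rfl <;> simp_all
  let F : posRoots n → (Finset.Icc (fun _ => -2 : Fin n → ℤ) (fun _ => 2)) × ℕ :=
    fun γ => (⟨γ.1.1, hmem γ⟩, γ.1.2.toNat)
  have hF : Function.Injective F := fun γ γ' e => by
    have e1 := congrArg (fun a => a.1.1) e
    have e2 := congrArg (fun a => a.2) e
    have h1 := posRoots_nonneg γ.2
    have h2 := posRoots_nonneg γ'.2
    simp only [F] at e1 e2
    exact Subtype.ext (Prod.ext e1 (by omega))
  have hs : Summable fun a : (Finset.Icc (fun _ => -2 : Fin n → ℤ) (fun _ => 2)) × ℕ =>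
      r ^ a.2 := by
    rw [summable_prod_of_nonneg fun a => pow_nonneg h0 _]
    exact ⟨fun _ => summable_geometric_of_lt_one h0 h1, Summable.of_finite⟩
  exact hs.comp_injective hF

/-- A summable bound for `1 / v_γ - 1` on the torus. -/
theorem exists_summable_bound {n : ℕ} {p : Params} {s : ℝ} (h : p.IsSmall s) (hn : 0 < n) :
    ∃ b : posRoots n → ℝ, Summable b ∧ (∀ γ, 0 ≤ b γ) ∧
      ∀ γ, ∀ x : Fin n → ℂ, (∀ k, ‖x k‖ = 1) → ‖(v p γ.1 x)⁻¹ - 1‖ ≤ b γ := by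
  have hqh : 0 < ‖(p.qh : ℂ)‖ := norm_pos_iff.2 (Units.ne_zero _)
  refine ⟨fun γ => 4 / (1 - s) ^ 2 * ‖(p.qh : ℂ)‖⁻¹ * ‖(p.qh : ℂ)‖ ^ γ.1.2.toNat,
    (summable_posRoots n hqh.le h.qh).mul_left _, fun γ => by positivity, fun γ x hx => ?_⟩
  refine (norm_v_inv_sub_one_le (k := ⟨0, hn⟩) h (fun i => Fin.le_def.2 (Nat.zero_le _)) γ.2
    hx).trans_eq ?_
  dsimp only
  rw [mul_assoc, ← zpow_natCast ‖(p.qh : ℂ)‖, Int.toNat_of_nonneg (posRoots_nonneg γ.2),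
    zpow_sub_one₀ hqh.ne', mul_comm (‖(p.qh : ℂ)‖ ^ γ.1.2)]

theorem multipliable_v_inv {n : ℕ} {p : Params} {s : ℝ} (h : p.IsSmall s) (hn : 0 < n)
    {x : Fin n → ℂ} (hx : ∀ k, ‖x k‖ = 1) :
    Multipliable fun γ : posRoots n => (v p γ.1 x)⁻¹ := by
  obtain ⟨b, hb, -, hb'⟩ := exists_summable_bound h hn
  have := multipliable_one_add_of_summable (f := fun γ : posRoots n => (v p γ.1 x)⁻¹ - 1)
    (Summable.of_nonneg_of_le (fun γ => norm_nonneg _) (fun γ => hb' γ x hx) hb)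
  simpa using this

/-- The bound is uniform in the finite set and in the point. It provides the dominating function for
the passage to the infinite product. -/
theorem exists_prod_bound {n : ℕ} {p : Params} {s : ℝ} (h : p.IsSmall s) (hn : 0 < n) :
    ∃ M : ℝ, ∀ (S : Finset (posRoots n)) (x : Fin n → ℂ), (∀ k, ‖x k‖ = 1) →
      ‖∏ γ ∈ S, (v p γ.1 x)⁻¹‖ ≤ M := by
  obtain ⟨b, hb, hb0, hb'⟩ := exists_summable_bound h hn
  refine ⟨Real.exp (∑' γ, b γ), fun S x hx => ?_⟩
  rw [norm_prod]
  calc _ ≤ ∏ γ ∈ S, (1 + b γ) := Finset.prod_le_prod (fun _ _ => norm_nonneg _) fun γ _ => by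
          have h1 := norm_add_le 1 ((v p γ.1 x)⁻¹ - 1)
          rw [add_sub_cancel, norm_one] at h1
          linarith [hb' γ x hx]
    _ ≤ Real.exp (∑ γ ∈ S, b γ) := Real.prod_one_add_le_exp_sum _ hb0
    _ ≤ _ := Real.exp_le_exp.2 (hb.sum_le_tsum _ fun γ _ => hb0 γ)

theorem tendsto_prod_Delta {n : ℕ} {p : Params} {s : ℝ} (h : p.IsSmall s) (hn : 0 < n)
    (θ : Fin n → ℝ) : Tendsto (fun S : Finset (posRoots n) =>
      ∏ γ ∈ S, (v p γ.1 (torusMap 0 1 θ))⁻¹) atTop (𝓝 (Delta p (torusMap 0 1 θ))) :=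
  (multipliable_v_inv h hn (norm_torusMap θ)).hasProd

theorem exists_norm_Delta_le {n : ℕ} {p : Params} {s : ℝ} (h : p.IsSmall s) (hn : 0 < n) :
    ∃ M : ℝ, ∀ θ : Fin n → ℝ, ‖Delta p (torusMap 0 1 θ)‖ ≤ M := by
  obtain ⟨M, hM⟩ := exists_prod_bound h hn
  exact ⟨M, fun θ => le_of_tendsto' (tendsto_prod_Delta h hn θ).norm fun S =>
    hM S _ (norm_torusMap θ)⟩

/-- On the torus Δ is a bounded pointwise limit of continuous finite products; its continuity is not
needed. -/
theorem integrableOn_mul_Delta {n : ℕ} {p : Params} {s : ℝ} (h : p.IsSmall s) (hn : 0 < n)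
    {φ : (Fin n → ℝ) → ℂ} (hφ : Continuous φ) :
    IntegrableOn (fun θ => φ θ * Delta p (torusMap 0 1 θ))
      (Set.Icc 0 fun _ => 2 * Real.pi) := by
  obtain ⟨M, hM⟩ := exists_norm_Delta_le h hn
  have hm : AEStronglyMeasurable (fun θ : Fin n → ℝ => Delta p (torusMap 0 1 θ))
      (volume.restrict (Set.Icc 0 fun _ => 2 * Real.pi)) :=
    aestronglyMeasurable_of_tendsto_ae (atTop : Filter (Finset (posRoots n)))
      (fun S => (continuous_finsetProd S fun γ _ =>
        continuous_v_inv_torusMap h hn γ.2).aestronglyMeasurable)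
      (Eventually.of_forall fun θ => tendsto_prod_Delta h hn θ)
  exact Integrable.mul_bdd hφ.integrableOn_Icc hm (Eventually.of_forall hM)

theorem integrableOn_eval_mul_Delta {n : ℕ} {p : Params} {s : ℝ} (h : p.IsSmall s) (hn : 0 < n)
    (f g : Laurent n) : IntegrableOn (fun θ =>
      eval (torusMap 0 1 θ) f * eval (torusMap 0 1 θ) g * Delta p (torusMap 0 1 θ))
      (Set.Icc 0 fun _ => 2 * Real.pi) :=
  integrableOn_mul_Delta h hn ((continuous_eval_torusMap f).mul (continuous_eval_torusMap g))

/-! ### Symmetry of the `T_i` -/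

theorem eval_T {n : ℕ} (p : Params) (i : Fin (n + 1)) (f : Laurent n) {x : Fin n → ℂ}
    (hx : ∀ k, x k ≠ 0) : eval x (T p i f) =
      p.mult (simpleRoot (n := n) i) * eval x f - (p.mult (simpleRoot (n := n) i) : ℂ)⁻¹ *
        (eval x (vNum p (simpleRoot i)) * eval x (divDiff p (simpleRoot i) f)) := by
  rw [← evalHom_apply hx, T_apply, map_sub, map_smul, map_smul, map_mul]
  simp only [evalHom_apply, smul_eq_mul]

theorem eval_mul_divDiff {n : ℕ} (p : Params) (β : AffLat n) (f : Laurent n) {x : Fin n → ℂ}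
    (hx : ∀ k, x k ≠ 0) : (1 - rootVal p β x) * eval x (divDiff p β f) =
      eval x f - eval x (reflAct p β f) := by
  have := congrArg (evalHom x hx) (mul_divDiff p β f)
  rw [map_mul, map_sub _ f] at this
  simpa only [evalHom_apply, eval_one_sub_mono p β hx] using this

/-- The scalar terms t_i f g cancel in the difference, and so do the products f g hidden in f - s_i
f and g - s_i g. The remaining factor v_{a_i} cancels the factor of a_i in the product. -/
theorem prod_mul_T_sub {n : ℕ} (p : Params) (i : Fin (n + 1)) {S : Finset (AffLat n)}
    (hS : simpleRoot i ∉ S) (f g : Laurent n) {x : Fin n → ℂ} (hx : ∀ k, x k ≠ 0)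
    (hv : eval x (vNum p (simpleRoot i)) ≠ 0) :
    (eval x (T p i f) * eval x g - eval x f * eval x (T p i g)) *
      ∏ γ ∈ insert (simpleRoot i) S, (v p γ x)⁻¹ =
    -(p.mult (simpleRoot (n := n) i) : ℂ)⁻¹ * skewTerm p (simpleRoot i) S f g x := by
  rw [Finset.prod_insert hS, v_inv p _ hx, eval_T p i f hx, eval_T p i g hx, skewTerm]
  have h1 := eval_mul_divDiff p (simpleRoot i) f hx
  have h2 := eval_mul_divDiff p (simpleRoot i) g hx
  have h3 : eval x (vNum p (simpleRoot i)) * (eval x (vNum p (simpleRoot i)))⁻¹ = 1 :=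
    mul_inv_cancel₀ hv
  rw [div_eq_mul_inv]
  generalize (∏ γ ∈ S, (v p γ x)⁻¹) = P
  generalize eval x (vNum p (simpleRoot i)) = N at *
  generalize (p.mult (simpleRoot (n := n) i) : ℂ)⁻¹ = t'
  linear_combination (-t' * P * eval x g * N * N⁻¹) * h1 + (t' * P * eval x f * N * N⁻¹) * h2 +
    (t' * P * (eval x (reflAct p (simpleRoot i) f) * eval x g -
      eval x f * eval x (reflAct p (simpleRoot i) g))) * h3

/-- The bilinear form `(f, g) ↦ ∫ f g Δ` over the torus. -/
noncomputable def form {n : ℕ} (p : Params) (f g : Laurent n) : ℂ :=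
  ∫ θ in Set.Icc 0 (fun _ => 2 * Real.pi),
    eval (torusMap 0 1 θ) f * eval (torusMap 0 1 θ) g * Delta p (torusMap 0 1 θ)

theorem form_T {n : ℕ} {p : Params} {s : ℝ} (h : p.IsSmall s) (hn : 0 < n)
    (hq : (p.q : ℂ) = (‖(p.qh : ℂ)‖ : ℂ) ^ 2) (i : Fin (n + 1)) (f g : Laurent n) :
    form p (T p i f) g = form p f (T p i g) := by
  classical
  have hi := fun f g => integrableOn_eval_mul_Delta h hn f g
  rw [← sub_eq_zero, form, form, ← integral_sub (hi _ _) (hi _ _)]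
  set β : AffLat n := simpleRoot i with hβ
  have hβm : β ∈ posRoots n := simpleRoot_mem hn i
  have hβr : IsReflRoot β := isReflRoot_simpleRoot hn i
  set φ : (Fin n → ℝ) → ℂ := fun θ =>
    eval (torusMap 0 1 θ) (T p i f) * eval (torusMap 0 1 θ) g -
      eval (torusMap 0 1 θ) f * eval (torusMap 0 1 θ) (T p i g) with hφ
  have hφc : Continuous φ := ((continuous_eval_torusMap _).mul (continuous_eval_torusMap _)).sub
    ((continuous_eval_torusMap _).mul (continuous_eval_torusMap _))
  simp only [← sub_mul]
  -- A sequence of finite sets exhausting the positive roots, as dominated convergence is applied to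
  -- sequences. Each set is enlarged to one that contains a_i and is s_i-stable apart from a_i. The
  -- enlarged sets still exhaust, so unconditional convergence gives the limit Δ.
  obtain ⟨u, hu⟩ := exists_seq_tendsto (atTop : Filter (Finset (posRoots n)))
  let S₀ : ℕ → Finset (AffLat n) := fun N => ((u N).map (Function.Embedding.subtype _)).erase β
  let S : ℕ → Finset (AffLat n) := fun N => S₀ N ∪ (S₀ N).image (refl β)
  have hS₀ : ∀ N, ∀ γ ∈ S₀ N, γ ∈ posRoots n \ {β} := fun N γ hγ => by
    obtain ⟨h1, h2⟩ := Finset.mem_erase.1 hγ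
    obtain ⟨γ', -, rfl⟩ := Finset.mem_map.1 h2
    exact ⟨γ'.2, h1⟩
  have hS : ∀ N, ∀ γ ∈ S N, γ ∈ posRoots n \ {β} := fun N γ hγ => by
    rcases Finset.mem_union.1 hγ with h1 | h1
    · exact hS₀ N γ h1
    · obtain ⟨γ', h2, rfl⟩ := Finset.mem_image.1 h1
      exact refl_simpleRoot_mem hn i (hS₀ N γ' h2)
  have hS' : ∀ N, ∀ γ ∈ S N, refl β γ ∈ S N := fun N γ hγ => by
    rcases Finset.mem_union.1 hγ with h1 | h1
    · exact Finset.mem_union_right _ (Finset.mem_image_of_mem _ h1)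
    · obtain ⟨γ', h2, rfl⟩ := Finset.mem_image.1 h1
      rw [hβr.refl_refl]
      exact Finset.mem_union_left _ h2
  let U : ℕ → Finset (posRoots n) := fun N => (insert β (S N)).subtype (· ∈ posRoots n)
  have huU : ∀ N, u N ≤ U N := fun N γ hγ => by
    rw [Finset.mem_subtype]
    by_cases e : γ.1 = β
    · rw [e]; exact Finset.mem_insert_self _ _
    · refine Finset.mem_insert_of_mem (Finset.mem_union_left _ (Finset.mem_erase.2 ⟨e, ?_⟩))
      exact Finset.mem_map_of_mem _ hγ
  have hU : Tendsto U atTop atTop := tendsto_atTop_mono huU hu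
  have hUprod : ∀ N (x : Fin n → ℂ),
      ∏ γ ∈ U N, (v p γ.1 x)⁻¹ = ∏ γ ∈ insert β (S N), (v p γ x)⁻¹ := fun N x =>
    Finset.prod_subtype_of_mem (fun γ => (v p γ x)⁻¹) fun γ hγ => by
      rcases Finset.mem_insert.1 hγ with rfl | h1
      · exact hβm
      · exact (hS N γ h1).1
  have hzero : ∀ N, ∫ θ in Set.Icc 0 (fun _ => 2 * Real.pi),
      φ θ * ∏ γ ∈ U N, (v p γ.1 (torusMap 0 1 θ))⁻¹ = 0 := fun N => by
    have e : ∀ θ : Fin n → ℝ, φ θ * ∏ γ ∈ U N, (v p γ.1 (torusMap 0 1 θ))⁻¹ =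
        -(p.mult β : ℂ)⁻¹ * skewTerm p β (S N) f g (torusMap 0 1 θ) := fun θ => by
      rw [hUprod, hφ]
      exact prod_mul_T_sub p i (fun h1 => (hS N _ h1).2 rfl) f g (torusMap_ne_zero θ)
        (eval_vNum_ne_zero (k := ⟨0, hn⟩) h (fun i => Fin.le_def.2 (Nat.zero_le _)) hβm
          (norm_torusMap θ))
    simp only [e, integral_const_mul, hβ]
    rw [integral_skewTerm_eq_zero h hn hq i (hS N) (hS' N) f g, mul_zero]
  obtain ⟨M, hM⟩ := exists_prod_bound h hn
  have hlim : Tendsto (fun N => ∫ θ in Set.Icc 0 (fun _ => 2 * Real.pi),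
      φ θ * ∏ γ ∈ U N, (v p γ.1 (torusMap 0 1 θ))⁻¹) atTop
      (𝓝 (∫ θ in Set.Icc 0 (fun _ => 2 * Real.pi), φ θ * Delta p (torusMap 0 1 θ))) := by
    refine tendsto_integral_of_dominated_convergence (fun θ => ‖φ θ‖ * M) (fun N => ?_) ?_
      (fun N => Eventually.of_forall fun θ => ?_) (Eventually.of_forall fun θ => ?_)
    · exact (hφc.mul (continuous_finsetProd _ fun γ _ =>
        continuous_v_inv_torusMap h hn γ.2)).aestronglyMeasurable
    · exact (hφc.norm.mul continuous_const).integrableOn_Icc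
    · rw [norm_mul]
      gcongr
      exact hM _ _ (norm_torusMap θ)
    · exact ((tendsto_prod_Delta h hn θ).comp hU).const_mul _
  simp only [hzero] at hlim
  exact (tendsto_nhds_unique hlim tendsto_const_nhds)

/-! ### The spectral points are pairwise distinct -/

/-- `sgn(λ_k)` times the contribution of the pair `{k, j}` to the `k`-th coordinate of `ρ_m(λ)`. -/
def pairTerm {n : ℕ} (l : Fin n → ℤ) (k j : Fin n) : ℤ :=
  if k < j then sgn (l k) * (sgn (l k - l j) + sgn (l k + l j))
  else if j < k then sgn (l k) * (sgn (l j + l k) - sgn (l j - l k))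
  else 0

theorem sgn_mul_self (m : ℤ) : sgn m * sgn m = 1 := by
  unfold sgn; split_ifs <;> rfl

/-- The summand of the pair i < j is supported on the coordinates i and j. Collecting the coordinate
k and using sgn² = 1 pulls out the sign. -/
theorem rhoM_apply {n : ℕ} (l : Fin n → ℤ) (k : Fin n) :
    rhoM l k = sgn (l k) * ∑ j, pairTerm l k j := by
  have h1 : ∀ i j : Fin n, i < j → (sgn (l i - l j) • (Pi.single i (1 : ℤ) - Pi.single j 1) +
      sgn (l i + l j) • (Pi.single i (1 : ℤ) + Pi.single j 1) : Fin n → ℤ) k =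
      (if i = k then sgn (l k) * pairTerm l k j else 0) +
        (if j = k then sgn (l k) * pairTerm l k i else 0) := by
    intro i j hij
    by_cases e : i = k
    · subst e
      simp [hij.ne, hij.ne', pairTerm, hij, ← mul_assoc, sgn_mul_self]
    · by_cases e' : j = k
      · subst e'
        simp [hij.ne, pairTerm, hij, hij.not_gt, ← mul_assoc, sgn_mul_self]
        ring
      · simp [e, e', Ne.symm e, Ne.symm e']
  have h2 : rhoM l k = ∑ i, ∑ j ∈ Finset.Ioi i,
      ((if i = k then sgn (l k) * pairTerm l k j else 0) +
        (if j = k then sgn (l k) * pairTerm l k i else 0)) := by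
    rw [rhoM, Finset.sum_apply]
    refine Finset.sum_congr rfl fun i _ => ?_
    rw [Finset.sum_apply]
    exact Finset.sum_congr rfl fun j hj => h1 i j (Finset.mem_Ioi.1 hj)
  have h3 : ∀ i, ∑ j ∈ Finset.Ioi i, ((if i = k then sgn (l k) * pairTerm l k j else 0) +
        (if j = k then sgn (l k) * pairTerm l k i else 0)) =
      (if i = k then ∑ j ∈ Finset.Ioi k, sgn (l k) * pairTerm l k j else 0) +
        (if i < k then sgn (l k) * pairTerm l k i else 0) := by
    intro i
    rw [Finset.sum_add_distrib, Finset.sum_ite_eq' (Finset.Ioi i) k]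
    congr 1
    · split_ifs with h
      · rw [h]
      · exact Finset.sum_const_zero
    · simp only [Finset.mem_Ioi]
  have h4 : ∀ j : Fin n, (if k < j then sgn (l k) * pairTerm l k j else 0) +
      (if j < k then sgn (l k) * pairTerm l k j else 0) = sgn (l k) * pairTerm l k j := by
    intro j
    rcases lt_trichotomy k j with h | h | h
    · simp only [h, h.not_gt, if_true, if_false, add_zero]
    · subst h
      simp only [lt_irrefl, if_false, pairTerm, mul_zero, add_zero]
    · simp only [h, h.not_gt, if_true, if_false, zero_add]
  rw [h2, Finset.mul_sum, ← Finset.sum_congr rfl fun j _ => h4 j,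
    Finset.sum_congr rfl fun i _ => h3 i, Finset.sum_add_distrib, Finset.sum_add_distrib,
    Finset.sum_ite_eq' Finset.univ k, if_pos (Finset.mem_univ k), ← Finset.filter_lt_eq_Ioi,
    Finset.sum_filter]

/-- A pair acts as a contest: the entry of larger absolute value gets 2 and the other 0. A tie is
decided by the sign of the entry with the smaller label. -/
theorem pairTerm_add {n : ℕ} (l : Fin n → ℤ) {k j : Fin n} (h : k ≠ j) :
    pairTerm l k j + pairTerm l j k = 2 := by
  rcases h.lt_or_gt with h | h <;> simp only [pairTerm, h, h.not_gt, if_true, if_false, sgn] <;>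
    split_ifs <;> omega

theorem pairTerm_of_lt {n : ℕ} (l : Fin n → ℤ) {k j : Fin n} (h : |l j| < |l k|) :
    pairTerm l k j = 2 := by
  have hne : k ≠ j := fun e => by rw [e] at h; exact lt_irrefl _ h
  have h0 := le_abs_self (l j)
  have h1 := neg_abs_le (l j)
  rcases abs_cases (l k) with ⟨h2, h2'⟩ | ⟨h2, h2'⟩ <;> rcases hne.lt_or_gt with h' | h' <;>
    simp only [pairTerm, h', h'.not_gt, if_true, if_false, sgn] <;> split_ifs <;> omega

theorem pairTerm_mem {n : ℕ} (l : Fin n → ℤ) {k j : Fin n} (h : k ≠ j) :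
    0 ≤ pairTerm l k j ∧ pairTerm l k j ≤ 2 := by
  rcases h.lt_or_gt with h | h <;> simp only [pairTerm, h, h.not_gt, if_true, if_false, sgn] <;>
    split_ifs <;> omega

/-- The absolute value (up to sign) of the logarithm of a coordinate of `γ_λ`. -/
noncomputable def height {n : ℕ} (τ κ L : ℝ) (l : Fin n → ℤ) (k : Fin n) : ℝ :=
  τ + κ * (∑ j, pairTerm l k j : ℤ) + L * |l k|

theorem sum_pairTerm_nonneg {n : ℕ} (l : Fin n → ℤ) (k : Fin n) : 0 ≤ ∑ j, pairTerm l k j :=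
  Finset.sum_nonneg fun j _ => by
    by_cases h : k = j
    · subst h; simp [pairTerm]
    · exact (pairTerm_mem l h).1

theorem height_ge {n : ℕ} {τ κ L : ℝ} (hκ : 0 < κ) (l : Fin n → ℤ) (k : Fin n) :
    τ + L * |l k| ≤ height τ κ L l k := by
  have h : (0 : ℝ) ≤ (∑ j, pairTerm l k j : ℤ) := by exact_mod_cast sum_pairTerm_nonneg l k
  have := mul_nonneg hκ.le h
  rw [height]
  linarith

/-- Let v = |λ_{k₀}| be the largest absolute value among the entries of λ and μ at places where they
differ, and let S be the set of such places with |λ_k| = v. On S the heights agree although |μ_k| <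
v, so the pair terms of λ must have a smaller sum than those of μ. Summed over S, however, the terms
inside S cancel and those leaving S do not favour μ. -/
theorem eq_of_height_aux {n : ℕ} {τ κ L : ℝ} (hκ : 0 < κ) (hL : 0 < L) (hτ : 0 < 2 * τ + L)
    {l m : Fin n → ℤ} (h : ∀ k, sgn (l k) * height τ κ L l k = sgn (m k) * height τ κ L m k)
    (k₀ : Fin n) (hk₀ : l k₀ ≠ m k₀) (hl : ∀ k, l k ≠ m k → |l k| ≤ |l k₀|)
    (hm : ∀ k, l k ≠ m k → |m k| ≤ |l k₀|) : False := by
  classical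
  set v := |l k₀| with hv
  have hv1 : 1 ≤ v := by
    by_contra hlt
    have h1 : |l k₀| = 0 := le_antisymm (by omega) (abs_nonneg _)
    have h2 : |m k₀| = 0 := le_antisymm ((hm k₀ hk₀).trans (by omega)) (abs_nonneg _)
    exact hk₀ (by rw [abs_eq_zero.1 h1, abs_eq_zero.1 h2])
  set S : Finset (Fin n) := Finset.univ.filter fun k => l k ≠ m k ∧ |l k| = v with hS
  have hmemS : ∀ k, k ∈ S ↔ l k ≠ m k ∧ |l k| = v := fun k => by simp [hS]
  have hvR : (1 : ℝ) ≤ v := by exact_mod_cast hv1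
  have hlow : ∀ k ∈ S, τ + L ≤ height τ κ L l k := fun k hk => by
    have h1 := height_ge (τ := τ) (L := L) hκ l k
    rw [((hmemS k).1 hk).2] at h1
    have := mul_le_mul_of_nonneg_left hvR hL.le
    linarith
  have hlow' : ∀ k, τ ≤ height τ κ L m k := fun k => by
    have h1 := height_ge (τ := τ) (L := L) hκ m k
    have : (0 : ℝ) ≤ L * (|m k| : ℤ) := mul_nonneg hL.le (by exact_mod_cast abs_nonneg (m k))
    linarith
  -- Opposite signs would make the two heights add up to 0, whereas their sum is at least 2 τ + L >
  -- 0.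
  have heq : ∀ k ∈ S, sgn (l k) = sgn (m k) ∧ height τ κ L l k = height τ κ L m k := by
    intro k hk
    have h1 := h k
    have h2 := hlow k hk
    have h3 := hlow' k
    unfold sgn at h1 ⊢
    split_ifs at h1 ⊢ <;> push_cast at h1
    · exact ⟨rfl, by linarith⟩
    · linarith
    · linarith
    · exact ⟨rfl, by linarith⟩
  have hmlt : ∀ k ∈ S, |m k| < v := by
    intro k hk
    obtain ⟨h1, h2⟩ := (hmemS k).1 hk
    refine lt_of_le_of_ne (hm k h1) fun h3 => ?_
    have h4 := (heq k hk).1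
    rcases abs_eq_abs.1 (h3.trans h2.symm) with h5 | h5
    · exact h1 h5.symm
    · rw [h5] at h4
      have : l k ≠ 0 := fun e => by rw [e, abs_zero] at h2; omega
      unfold sgn at h4
      split_ifs at h4 <;> omega
  set d : Fin n → Fin n → ℤ := fun k j => pairTerm l k j - pairTerm m k j with hd
  have hanti : ∀ k j, d k j = -d j k := fun k j => by
    by_cases e : k = j
    · subst e; simp [hd, pairTerm]
    · have h1 := pairTerm_add l e
      have h2 := pairTerm_add m e
      simp only [hd]; omega
  have hin : ∑ k ∈ S, ∑ j ∈ S, d k j = 0 := by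
    have h1 : ∑ k ∈ S, ∑ j ∈ S, d k j = -∑ k ∈ S, ∑ j ∈ S, d k j := by
      conv_lhs => rw [Finset.sum_comm]
      simp only [← Finset.sum_neg_distrib]
      exact Finset.sum_congr rfl fun k _ => Finset.sum_congr rfl fun j _ => hanti j k
    omega
  -- If |λ_j| < v, then k wins against j in λ. Otherwise λ_j = μ_j by maximality, and j wins against
  -- k in μ because |μ_k| < v ≤ |μ_j|.
  have hout : ∀ k ∈ S, ∀ j ∈ Finset.univ \ S, 0 ≤ d k j := by
    intro k hk j hj
    have hjS : j ∉ S := (Finset.mem_sdiff.1 hj).2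
    have hne : k ≠ j := fun e => hjS (e ▸ hk)
    have h2 := ((hmemS k).1 hk).2
    rcases lt_or_ge |l j| v with h1 | h1
    · have h3 := pairTerm_of_lt l (k := k) (j := j) (by omega)
      have h4 := (pairTerm_mem m hne).2
      simp only [hd]; omega
    · have h3 : l j = m j := by
        by_contra h3
        exact hjS ((hmemS j).2 ⟨h3, le_antisymm (hl j h3) h1⟩)
      have h4 := pairTerm_of_lt m (k := j) (j := k) (by rw [← h3]; exact (hmlt k hk).trans_le h1)
      have h5 := pairTerm_add m hne
      have h6 := (pairTerm_mem l hne).1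
      simp only [hd]; omega
  have hsum : 0 ≤ ∑ k ∈ S, ∑ j, d k j := by
    have h1 : ∀ k, ∑ j, d k j = ∑ j ∈ Finset.univ \ S, d k j + ∑ j ∈ S, d k j := fun k =>
      (Finset.sum_sdiff (Finset.subset_univ S)).symm
    simp only [h1, Finset.sum_add_distrib, hin, add_zero]
    exact Finset.sum_nonneg fun k hk => Finset.sum_nonneg fun j hj => hout k hk j hj
  have hdiff : ∀ k ∈ S, κ * ((∑ j, d k j : ℤ) : ℝ) ≤ -L := by
    intro k hk
    have h1 := (heq k hk).2
    rw [height, height, ((hmemS k).1 hk).2] at h1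
    have h2 : (|m k| : ℤ) + (1 : ℝ) ≤ v := by exact_mod_cast hmlt k hk
    have h3 := mul_le_mul_of_nonneg_left h2 hL.le
    simp only [hd, Finset.sum_sub_distrib]
    push_cast at h1 h3 ⊢
    linarith
  have hk₀S : k₀ ∈ S := (hmemS k₀).2 ⟨hk₀, rfl⟩
  have h1 : κ * ((∑ k ∈ S, ∑ j, d k j : ℤ) : ℝ) < 0 := by
    rw [Int.cast_sum, Finset.mul_sum]
    exact Finset.sum_neg (fun k hk => (hdiff k hk).trans_lt (by linarith)) ⟨k₀, hk₀S⟩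
  have h2 : (0 : ℝ) ≤ ((∑ k ∈ S, ∑ j, d k j : ℤ) : ℝ) := by exact_mod_cast hsum
  have := mul_nonneg hκ.le h2
  linarith

theorem eq_of_height {n : ℕ} {τ κ L : ℝ} (hκ : 0 < κ) (hL : 0 < L) (hτ : 0 < 2 * τ + L)
    {l m : Fin n → ℤ} (h : ∀ k, sgn (l k) * height τ κ L l k = sgn (m k) * height τ κ L m k) :
    l = m := by
  classical
  by_contra hne
  obtain ⟨k₁, hk₁⟩ := Function.ne_iff.1 hne
  -- The place where the larger of the two absolute values is maximal; the hypotheses are symmetric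
  -- in λ and μ, so either one may attain it.
  obtain ⟨k₀, hk₀, hmax⟩ := (Finset.univ.filter fun k => l k ≠ m k).exists_max_image
    (fun k => max |l k| |m k|) ⟨k₁, by simpa using hk₁⟩
  simp only [Finset.mem_filter, Finset.mem_univ, true_and, max_le_iff, le_max_iff] at hk₀ hmax
  rcases le_total |m k₀| |l k₀| with h1 | h1
  · exact eq_of_height_aux hκ hL hτ h k₀ hk₀
      (fun k hk => (hmax k hk).elim And.left fun h => h.1.trans h1)
      (fun k hk => (hmax k hk).elim And.right fun h => h.2.trans h1)
  · exact eq_of_height_aux hκ hL hτ (fun k => (h k).symm) k₀ hk₀.symm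
      (fun k hk => (hmax k hk.symm).elim (fun h => h.2.trans h1) And.right)
      (fun k hk => (hmax k hk.symm).elim (fun h => h.1.trans h1) And.left)

theorem rhoL_apply {n : ℕ} (l : Fin n → ℤ) (k : Fin n) : rhoL l k = sgn (l k) := by
  have : sgn (2 * l k) = sgn (l k) := by
    unfold sgn; split_ifs <;> omega
  rw [rhoL, Finset.sum_apply, ← this]
  simp [Pi.single_apply]

theorem log_norm_gamma {n : ℕ} (p : Params) (l : Fin n → ℤ) (k : Fin n) :
    -Real.log ‖(gamma p l k : ℂ)‖ = sgn (l k) *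
      height (-Real.log ‖(p.t0 * p.tn : ℂ)‖) (-Real.log ‖(p.t : ℂ)‖) (-Real.log ‖(p.q : ℂ)‖) l k := by
  have h0 : ∀ u : ℂˣ, ‖(u : ℂ)‖ ≠ 0 := fun u => norm_ne_zero_iff.2 u.ne_zero
  have h1 : (sgn (l k) * |l k| : ℤ) = l k := by
    unfold sgn; split_ifs with h
    · rw [abs_of_nonneg h, one_mul]
    · rw [abs_of_neg (not_le.1 h)]; ring
  have h2 : (sgn (l k) : ℝ) * (|l k| : ℤ) = l k := by exact_mod_cast h1
  simp only [gamma, Units.val_mul, Units.val_zpow_eq_zpow_val, norm_mul, norm_zpow]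
  rw [Real.log_mul, Real.log_mul, Real.log_mul, Real.log_zpow, Real.log_zpow, Real.log_zpow,
    Real.log_zpow, Real.log_mul (h0 _) (h0 _), rhoL_apply, rhoM_apply, height]
  · rw [← h2]
    push_cast
    ring
  all_goals simp [zpow_ne_zero]

/-- The last bound is 2 τ + L > 0 for τ = -log |t_0 t_n| and L = -log |q|; the modulus of t_0 t_n
itself may exceed 1. -/
theorem gamma_injective {n : ℕ} {p : Params} (hq : ‖(p.q : ℂ)‖ < 1) (ht : ‖(p.t : ℂ)‖ < 1)
    (h : ‖(p.t0 * p.tn : ℂ)‖ ^ 2 * ‖(p.q : ℂ)‖ < 1) {l m : Fin n → ℤ}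
    (hlm : ∀ k, gamma p l k = gamma p m k) : l = m := by
  have h0 : ∀ u : ℂˣ, 0 < ‖(u : ℂ)‖ := fun u => norm_pos_iff.2 u.ne_zero
  have h1 : 0 < ‖(p.t0 * p.tn : ℂ)‖ := h0 (p.t0 * p.tn)
  refine eq_of_height (τ := -Real.log ‖(p.t0 * p.tn : ℂ)‖) (κ := -Real.log ‖(p.t : ℂ)‖)
    (L := -Real.log ‖(p.q : ℂ)‖) (neg_pos.2 (Real.log_neg (h0 _) ht))
    (neg_pos.2 (Real.log_neg (h0 _) hq)) ?_ fun k => ?_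
  · have h2 := Real.log_neg (mul_pos (pow_pos h1 2) (h0 p.q)) h
    rw [Real.log_mul (pow_pos h1 2).ne' (h0 _).ne', Real.log_pow] at h2
    push_cast at h2
    linarith
  · rw [← log_norm_gamma, ← log_norm_gamma, hlm]

/-! ### Separation of the spectral points by dominant weights -/

theorem gamma_inv {n : ℕ} (p : Params) (l : Fin n → ℤ) (k : Fin n) :
    gamma p.inv l k = (gamma p l k)⁻¹ := by
  simp only [gamma, Params.q_inv]
  simp [Params.inv, mul_comm]

theorem isDominant_indicator {n : ℕ} (P : Fin n → Prop) [DecidablePred P]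
    (hP : ∀ i j, i ≤ j → P j → P i) : IsDominant fun i => if P i then (1 : ℤ) else 0 := by
  refine ⟨fun i j hij => ?_, fun i => ?_⟩
  · have := hP i j hij
    dsimp only
    split_ifs <;> simp_all
  · dsimp only; split_ifs <;> simp

/-- Points with non-zero coordinates are separated by the monomials of dominant weight. -/
theorem eq_of_monoVal_dominant {n : ℕ} {x y : Fin n → ℂ} (hx : ∀ k, x k ≠ 0) (hy : ∀ k, y k ≠ 0)
    (h : ∀ ν, IsDominant ν → monoVal x ν = monoVal y ν) (k : Fin n) : x k = y k := by
  -- ε_k is the difference of the dominant weights ε_1 + ⋯ + ε_k and ε_1 + ⋯ + ε_{k-1}.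
  have h1 := h _ (isDominant_indicator (fun i => i ≤ k) fun i j hij hj => hij.trans hj)
  have h2 := h _ (isDominant_indicator (fun i => i < k) fun i j hij hj => hij.trans_lt hj)
  have e : (fun i => if i ≤ k then (1 : ℤ) else 0) =
      (fun i => if i < k then (1 : ℤ) else 0) + Pi.single k 1 := by
    ext i
    rcases lt_trichotomy i k with h | h | h
    · simp [h, h.le, h.ne]
    · simp [h]
    · simp [h.not_ge, h.not_gt, h.ne']
  have e' : ∀ z : Fin n → ℂ, monoVal z (Pi.single k 1) = z k := fun z => by
    rw [monoVal, Finset.prod_eq_single k]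
    · simp
    · intro j _ hj; simp [hj]
    · simp
  rw [e, monoVal_add hx, monoVal_add hy, h2, e', e'] at h1
  exact mul_left_cancel₀ (monoVal_ne_zero hy _) h1

/-! ### The `Y`-operators for dominant weights -/

theorem negWeight_of_isDominant {n : ℕ} {ν : Fin n → ℤ} (h : IsDominant ν) : negWeight ν = 0 := by
  have h1 : ∀ k, max (-fundCoeff ν k) 0 = 0 := fun k => by
    refine max_eq_right (neg_nonpos.2 ?_)
    unfold fundCoeff
    split_ifs with hk
    · exact sub_nonneg.2 (h.1 (Fin.le_def.2 (by simp)))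
    · simpa using h.2 k
  ext i
  simp [negWeight, h1]

theorem TTranslation_zero {n : ℕ} (p : Params) : TTranslation p (0 : Fin n → ℤ) = 1 := by
  have h0 : IsWordFor (0 : Fin n → ℤ) [] := fun g => by
    ext k <;> simp [wordAct, translation, dot]
  have h1 := (isReducedWordFor_reducedWord (0 : Fin n → ℤ)).2 [] h0
  have h2 : reducedWord (0 : Fin n → ℤ) = [] := List.eq_nil_of_length_eq_zero (by simpa using h1)
  simp [TTranslation, h2]

/-- For a dominant weight Y^ν is a plain product of the T_i, as the inverted factor is the identity.
These weights already separate the spectrum, so no other Y^λ is needed. -/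
theorem evalY_single_of_isDominant {n : ℕ} (p : Params) {ν : Fin n → ℤ} (h : IsDominant ν) :
    evalY p (AddMonoidAlgebra.single ν 1) = TTranslation p (posWeight ν) := by
  rw [evalY, AddMonoidAlgebra.coeff_single, Finsupp.sum_single_index (by simp), Y,
    negWeight_of_isDominant h, TTranslation_zero, Ring.inverse_one, mul_one, one_smul]

theorem IsKoornwinderE.TTranslation_apply {n : ℕ} {p : Params} {l : Fin n → ℤ} {E : Laurent n}
    (hE : IsKoornwinderE p l E) {ν : Fin n → ℤ} (hν : IsDominant ν) :
    TTranslation p (posWeight ν) E = monoVal (fun k => (gamma p l k : ℂ)) ν • E := by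
  obtain ⟨P, hP, ⟨z, rfl⟩, -⟩ := hE
  have := hP.eigen (AddMonoidAlgebra.single ν 1)
  rw [evalY_single_of_isDominant p hν, eval_single, one_mul] at this
  rw [map_smul, this, smul_comm]

/-! ### Orthogonality -/

theorem form_smul_smul {n : ℕ} (p : Params) (a b : ℂ) (f g : Laurent n) :
    form p (a • f) (b • g) = a * b * form p f g := by
  rw [form, form, ← integral_const_mul]
  congr 1
  ext θ
  simp only [← evalHom_apply (torusMap_ne_zero θ), map_smul, smul_eq_mul]
  ring

theorem form_T_varInv {n : ℕ} {p : Params} {s : ℝ} (h : p.IsSmall s) (hn : 0 < n)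
    (hq : (p.q : ℂ) = (‖(p.qh : ℂ)‖ : ℂ) ^ 2) (i : Fin (n + 1)) (f g : Laurent n) :
    form p (T p i f) (varInv (T p.inv i g)) = form p f (varInv g) := by
  have hr := isReflRoot_simpleRoot hn i
  rw [form_T h hn hq, varInv_T p i hr, T_TInv p i hr]

/-- The outermost operators cancel first, one letter at a time, so the same word occurs on both
sides without reversal. -/
theorem form_word_varInv {n : ℕ} {p : Params} {s : ℝ} (h : p.IsSmall s) (hn : 0 < n)
    (hq : (p.q : ℂ) = (‖(p.qh : ℂ)‖ : ℂ) ^ 2) (w : List (Fin (n + 1))) (f g : Laurent n) :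
    form p ((w.map (T p)).prod f) (varInv ((w.map (T p.inv)).prod g)) = form p f (varInv g) := by
  induction w with
  | nil => simp
  | cons i w ih =>
    simp only [List.map_cons, List.prod_cons, Module.End.mul_apply]
    rw [form_T_varInv h hn hq, ih]

theorem form_eq_zero {n : ℕ} {p : Params} {s : ℝ} (h : p.IsSmall s) (hn : 0 < n)
    (hq : (p.q : ℂ) = (‖(p.qh : ℂ)‖ : ℂ) ^ 2)
    (hγ : ‖(p.t0 * p.tn : ℂ)‖ ^ 2 * ‖(p.q : ℂ)‖ < 1) (ht : ‖(p.t : ℂ)‖ < 1)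
    {l m : Fin n → ℤ} (hlm : l ≠ m) {E E' : Laurent n}
    (hE : IsKoornwinderE p l E) (hE' : IsKoornwinderE p.inv m E') :
    form p E (varInv E') = 0 := by
  by_contra h0
  have hq1 : ‖(p.q : ℂ)‖ < 1 := by
    rw [Params.q, Units.val_pow_eq_pow_val, norm_pow]
    exact pow_lt_one₀ (norm_nonneg _) h.qh two_ne_zero
  refine hlm (gamma_injective hq1 ht hγ fun k => Units.ext ?_)
  refine eq_of_monoVal_dominant (x := fun k => (gamma p l k : ℂ))
    (y := fun k => (gamma p m k : ℂ)) (fun k => Units.ne_zero _) (fun k => Units.ne_zero _)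
    (fun ν hν => ?_) k
  -- The chosen reduced word does not involve the parameters, so it serves both 𝐭 and 𝐭⁻¹.
  have h1 := form_word_varInv h hn hq (reducedWord (posWeight ν)) E E'
  change form p (TTranslation p (posWeight ν) E)
    (varInv (TTranslation p.inv (posWeight ν) E')) = _ at h1
  rw [hE.TTranslation_apply hν, hE'.TTranslation_apply hν, map_smul, form_smul_smul] at h1
  have h2 : monoVal (fun k => (gamma p.inv m k : ℂ)) ν =
      (monoVal (fun k => (gamma p m k : ℂ)) ν)⁻¹ := by
    simp [monoVal, gamma_inv]
  have h3 := mul_right_cancel₀ h0 (h1.trans (one_mul _).symm)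
  rw [h2] at h3
  exact (mul_inv_eq_one₀ (monoVal_ne_zero (fun k => Units.ne_zero _) ν)).1 h3

theorem integrand_torusMap {n : ℕ} (p : Params) (f g : Laurent n) (θ : Fin n → ℝ) :
    integrand p f g (torusMap 0 1 θ) =
      eval (torusMap 0 1 θ) f * eval (torusMap 0 1 θ) (varInv g) * (∏ k, (torusMap 0 1 θ k)⁻¹) *
        Delta p (torusMap 0 1 θ) := by
  rw [integrand, eval_varInv (torusMap_ne_zero θ)]
  ring

theorem torusIntegrable_integrand {n : ℕ} {p : Params} {s : ℝ} (h : p.IsSmall s) (hn : 0 < n)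
    (f g : Laurent n) : TorusIntegrable (integrand p f g) 0 1 := by
  simp only [TorusIntegrable, integrand_torusMap]
  refine integrableOn_mul_Delta h hn (((continuous_eval_torusMap f).mul
    (continuous_eval_torusMap _)).mul (continuous_finsetProd _ fun k _ => ?_))
  refine Continuous.inv₀ ?_ fun θ => torusMap_ne_zero θ k
  simp only [torusMap_apply]
  exact (continuous_circleMap 0 1).comp (continuous_apply k)

/-- Since dx_k = i x_k dθ_k, the Jacobian cancels (x_1 ⋯ x_n)⁻¹ up to iⁿ. -/
theorem pairing_eq_form {n : ℕ} (p : Params) (f g : Laurent n) :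
    pairing p f g = ((2 * Real.pi * Complex.I) ^ n)⁻¹ * (Complex.I ^ n * form p f (varInv g)) := by
  rw [pairing, torusIntegral, form, ← integral_const_mul (Complex.I ^ n)]
  congr 2
  ext θ
  have h1 : (∏ i, ((1 : Fin n → ℝ) i : ℂ) * Complex.exp (θ i * Complex.I) * Complex.I) =
      Complex.I ^ n * ∏ k, torusMap 0 1 θ k := by
    rw [Finset.prod_mul_distrib, mul_comm]
    simp [torusMap]
  have h2 : (∏ k, torusMap (0 : Fin n → ℂ) 1 θ k) * ∏ k, (torusMap 0 1 θ k)⁻¹ = 1 := by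
    rw [← Finset.prod_mul_distrib]
    exact Finset.prod_eq_one fun k _ => mul_inv_cancel₀ (torusMap_ne_zero θ k)
  rw [integrand_torusMap, h1, smul_eq_mul]
  linear_combination (Complex.I ^ n * (eval (torusMap 0 1 θ) f * eval (torusMap 0 1 θ) (varInv g) *
    Delta p (torusMap 0 1 θ))) * h2

end Koornwinder

theorem mainTheorem3 (n : ℕ) (hn : 2 ≤ n) (q t : ℝ) (hq0 : 0 < q) (hq1 : q < 1)
    (ht0 : 0 < t) (ht1 : t < 1) (p : Koornwinder.Params)
    (hpq : (p.q : ℂ) = (q : ℂ)) (hpt : (p.t : ℂ) = (t : ℂ))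
    (ha : ‖p.a‖ < 1) (hb : ‖p.b‖ < 1) (hc : ‖p.c‖ < 1) (hd : ‖p.d‖ < 1)
    (l m : Fin n → ℤ) (hlm : l ≠ m) (E E' : Koornwinder.Laurent n)
    (hE : Koornwinder.IsKoornwinderE p l E) (hE' : Koornwinder.IsKoornwinderE p.inv m E') :
    (∀ x : Fin n → ℂ, (∀ k, ‖x k‖ = 1) →
      Multipliable fun β : Koornwinder.posRoots n => (Koornwinder.v p β.1 x)⁻¹) ∧
    TorusIntegrable (Koornwinder.integrand p E E') 0 1 ∧
    Koornwinder.pairing p E E' = 0 := by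
  have hn0 : 0 < n := by omega
  have hqn : ‖(p.q : ℂ)‖ = q := by rw [hpq, Complex.norm_of_nonneg hq0.le]
  have htn : ‖(p.t : ℂ)‖ = t := by rw [hpt, Complex.norm_of_nonneg ht0.le]
  have hqh2 : ‖(p.qh : ℂ)‖ ^ 2 = q := by
    rw [← hqn, Koornwinder.Params.q, Units.val_pow_eq_pow_val, norm_pow]
  have hqh : ‖(p.qh : ℂ)‖ < 1 := by
    refine lt_of_pow_lt_pow_left₀ 2 zero_le_one ?_
    rw [hqh2, one_pow]
    exact hq1
  -- The chosen square root may be negative; q > 0 still gives q = |q^{1/2}|², so the circle fixed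
  -- by x_1 ↦ q / x_1 has radius |q^{1/2}|.
  have hq : (p.q : ℂ) = (‖(p.qh : ℂ)‖ : ℂ) ^ 2 := by
    rw [hpq, ← hqh2]
    push_cast
    rfl
  have hs : p.IsSmall (max (t ^ 2) (max (max ‖p.a‖ ‖p.b‖) (max ‖p.c‖ ‖p.d‖))) :=
    { lt_one := max_lt (pow_lt_one₀ ht0.le ht1 two_ne_zero) (max_lt (max_lt ha hb) (max_lt hc hd))
      qh := hqh
      t := by rw [norm_pow, htn]; exact le_max_left _ _
      a := by simp
      b := by simp
      c := by simp
      d := by simp }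
  have hγ : ‖(p.t0 * p.tn : ℂ)‖ ^ 2 * ‖(p.q : ℂ)‖ < 1 := by
    -- The product abcd equals (t_0 t_n)² q: both t_0^∨ and t_n^∨ drop out.
    have e : p.a * p.b * (p.c * p.d) = (p.t0 * p.tn : ℂ) ^ 2 * p.q := by
      simp only [Koornwinder.Params.a, Koornwinder.Params.b, Koornwinder.Params.c,
        Koornwinder.Params.d, Koornwinder.Params.q, Units.val_pow_eq_pow_val]
      field_simp
    rw [← norm_pow, ← norm_mul, ← e, norm_mul, norm_mul, norm_mul]
    exact mul_lt_one_of_nonneg_of_lt_one_left (by positivity)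
      (mul_lt_one_of_nonneg_of_lt_one_left (norm_nonneg _) ha hb.le)
      (mul_lt_one_of_nonneg_of_lt_one_left (norm_nonneg _) hc hd.le).le
  refine ⟨fun x hx => Koornwinder.multipliable_v_inv hs hn0 hx,
    Koornwinder.torusIntegrable_integrand hs hn0 E E', ?_⟩
  rw [Koornwinder.pairing_eq_form,
    Koornwinder.form_eq_zero hs hn0 hq hγ (by rw [htn]; exact ht1) hlm hE hE', mul_zero, mul_zero]
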